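/- Let $\mathbb T^2=\mathbb R^2/\mathbb Z^2$, let $V\in C^\infty(\mathbb T^2,\mathbb R)$, and let $\hbar\to0^+$ along a sequence, with $\varepsilon_\hbar>0$ such that $\hbar^2\ll\varepsilon_\hbar\ll\hbar$ (i.e. $\hbar^2/\varepsilon_\hbar\to0$ and $\varepsilon_\hbar/\hbar\to0$). Put $\tau_\hbar^c=\hbar/\varepsilon_\hbar$. For initial data $\psi_\hbar\in L^2(\mathbb T^2)$ let $u_\hbar,u_\hbar^\varepsilon\in C(\mathbb R;L^2(\mathbb T^2))$ be the solutions of $$i\hbar\partial_tu_\hbar=-\tfrac{\hbar^2}{2}\Delta u_\hbar,\qquad i\hbar\partial_tu^\varepsilon_\hbar=-\tfrac{\hbar^2}{2}\Delta u^\varepsilon_\hbar+\varepsilon_\hbar Vu^\varepsilon_\hbar,\qquad u_\hbar(0)=u^\varepsilon_\hbar(0)=\psi_\hbar .$$ The echo at time $s$ is $|\langle u^\varepsilon_\hbar(s),u_\hbar(s)\rangle_{L^2}|^2$ with $\langle u,v\rangle_{L^2}=\int_{\mathbb T^2}\bar u v$. Write $e_k(x)=e^{2\pi i k\cdot x}$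 for $k\in\mathbb Z^2$. Let $\mathcal L_1$ be the set of primitive rank one sublattices $\Lambda\subset\mathbb Z^2$ (primitive: $\langle\Lambda\rangle\cap\mathbb Z^2=\Lambda$, where $\langle\Lambda\rangle$ is the real span). For $\Lambda\in\mathcal L_1$ let $v_\Lambda$ be a generator, $v_\Lambda=(a,b)$, $v_\Lambda^\perp=(-b,a)$, $L_\Lambda=\|v_\Lambda\|$, and for a function $f$ on $\mathbb T^2$ set $$\mathcal I_\Lambda(f)(x)=\frac1{L_\Lambda}\int_0^{L_\Lambda}f\Big(x+s\,\frac{v_\Lambda^\perp}{L_\Lambda}\Big)ds .$$ Let $\Lambda^\perp\in\mathcal L_1$ be the lattice of integer vectors orthogonal to $\Lambda$. The rational unit vectors are the vectors $v/\|v\|$, with $v$ a generator of some $\Lambda\in\mathcal L_1$; the other unit vectors are called irrational. Fix $t\in\mathbb R$. (1) Let $\psi_\hbar=e_{k(\hbar)}$ with $k(\hbar)\in\mathbb Z^2$ and $\|k(\hbar)\|=\hbar^{-1}$. Suppose that either (a) $k(\hbar)/\|k(\hbar)\|$ converges to an irrational unit vector; or (b) $k(\hbar)=n(\hbar)v_{\Lambda_0}+m(\hbar)v_{\Lambda_0}^\perp$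 for some fixed $\Lambda_0\in\mathcal L_1$ and real $n(\hbar),m(\hbar)$ with $\hbar|m(\hbar)|\to0$ and $2\pi|m(\hbar)|\hbar^2\varepsilon_\hbar^{-1}\to+\infty$. Then $$\lim_{\hbar\to0^+}|\langle u^\varepsilon_\hbar(t\tau^c_\hbar),u_\hbar(t\tau^c_\hbar)\rangle|^2=1 .$$ (2) Let $\psi_\hbar=e_{k(\hbar)}$ with $k(\hbar)\in\mathbb Z^2$, $\|k(\hbar)\|=\hbar^{-1}$ and $k(\hbar)=n(\hbar)v_{\Lambda_0}+m(\hbar)v_{\Lambda_0}^\perp$ for some fixed $\Lambda_0\in\mathcal L_1$ and real $n(\hbar),m(\hbar)$ with $\hbar|m(\hbar)|\to0$ and $2\pi m(\hbar)\hbar^2\varepsilon_\hbar^{-1}\to\omega\in\mathbb R$. Then $$\lim_{\hbar\to0^+}|\langle u^\varepsilon_\hbar(t\tau^c_\hbar),u_\hbar(t\tau^c_\hbar)\rangle|^2=\Big|\int_{\mathbb T^2}e^{\,i\int_0^t\mathcal I_{\Lambda_0^\perp}(V)(x+s\omega v_{\Lambda_0}^\perp)\,ds}\,dx\Big|^2 .$$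 (3) Let $\Lambda_1\neq\Lambda_2$ in $\mathcal L_1$ and let $k(\hbar)=n_1(\hbar)v_{\Lambda_1}+m_1(\hbar)v_{\Lambda_1}^\perp$ and $l(\hbar)=n_2(\hbar)v_{\Lambda_2}+m_2(\hbar)v_{\Lambda_2}^\perp$ be points of $\mathbb Z^2$ (with real coefficients $n_j(\hbar),m_j(\hbar)$) such that $\|k(\hbar)\|=\|l(\hbar)\|=\hbar^{-1}$ and $2\pi m_j(\hbar)\hbar^2\varepsilon_\hbar^{-1}\to\omega_j\in\mathbb R$ for $j=1,2$. (Then $k(\hbar)\ne l(\hbar)$ for small $\hbar$.) Let $\psi_\hbar=\frac1{\sqrt2}(e_{k(\hbar)}+e_{l(\hbar)})$. Then $$\lim_{\hbar\to0^+}|\langle u^\varepsilon_\hbar(t\tau^c_\hbar),u_\hbar(t\tau^c_\hbar)\rangle|^2=\Big|\frac12\sum_{j=1}^2\int_{\mathbb T^2}e^{\,i\int_0^t\mathcal I_{\Lambda_j^\perp}(V)(x+s\omega_j v_{\Lambda_j}^\perp)\,ds}\,dx\Big|^2 .$$ -/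

import Mathlib

open Filter Topology MeasureTheory

noncomputable section

namespace LoschmidtEcho

/-! ### The torus `ℝ² / ℤ²` -/

/-- The Euclidean plane. -/
abbrev Plane : Type := EuclideanSpace ℝ (Fin 2)

/-- The integer lattice `ℤ²`. -/
abbrev IntLattice : Type := Fin 2 → ℤ

/-- The standard torus `ℝ² / ℤ²`. -/
abbrev Torus : Type := UnitAddTorus (Fin 2)

/-- The canonical projection `ℝ² → ℝ² / ℤ²`. -/
def proj (y : Plane) : Torus := fun i => ((y i : ℝ) : UnitAddCircle)

/-- The Lebesgue (Haar) measure on the torus, of total mass one. -/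
abbrev torusMeasure : Measure Torus := Measure.pi fun _ : Fin 2 => AddCircle.haarAddCircle

/-- The space `L²(𝕋²; ℂ)`; its inner product `inner ℂ u v` is `∫ conj u * v`. -/
abbrev L2Torus : Type := Lp ℂ 2 torusMeasure

open scoped ContDiff in
/-- `f` is of class `C^∞` on the torus: its periodic lift to the plane is. -/
def IsSmooth {F : Type*} [NormedAddCommGroup F] [NormedSpace ℝ F] (f : Torus → F) : Prop :=
  ContDiff ℝ ∞ fun y : Plane => f (proj y)

/-- The Laplacian on the torus: the Euclidean Laplacian at the origin of the lift of `f`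
to the plane, translated so that the origin lies over `x`. -/
def torusLaplacian (f : Torus → ℂ) (x : Torus) : ℂ :=
  Laplacian.laplacian (fun y : Plane => f (x + proj y)) 0

/-- The plane wave `x ↦ exp (2 π i k·x)` as an element of `L²(𝕋²)`. -/
def planeWave (k : IntLattice) : L2Torus := UnitAddTorus.mFourierLp 2 k

/-- `u ∈ C(ℝ; L²(𝕋²))` solves `i h ∂ₛ u = -(h² / 2) Δ u + W u`, in the sense of distributions
on `𝕋²` at every time `s`, with `u = ψ` at time `0`. -/
structure IsSchrodingerSolution (h : ℝ) (W : Torus → ℝ) (ψ : L2Torus) (u : ℝ → L2Torus) :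
    Prop where
  continuous : Continuous u
  initial : u 0 = ψ
  equation : ∀ φ : Torus → ℂ, IsSmooth φ → ∀ s : ℝ,
    ∃ d : ℂ, HasDerivAt (fun r : ℝ => ∫ x, φ x * u r x ∂torusMeasure) d s ∧
      Complex.I * (h : ℂ) * d =
        ∫ x, (-((h : ℂ) ^ 2 / 2) * torusLaplacian φ x + (W x : ℂ) * φ x) * u s x ∂torusMeasure

/-- The quantum Loschmidt echo at time `s` of two evolutions. -/
def echo (uε u : ℝ → L2Torus) (s : ℝ) : ℝ := ‖inner ℂ (uε s) (u s)‖ ^ 2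

/-! ### Primitive sublattices of rank one and averages along periodic directions -/

/-- A lattice vector as a vector of the Euclidean plane. -/
def toPlane (k : IntLattice) : Plane := WithLp.toLp 2 fun i => (k i : ℝ)

/-- The lattice vector directly orthogonal to `v`, of the same length. -/
def rot (v : IntLattice) : IntLattice := ![-v 1, v 0]

/-- `Λ` has rank one and `⟨Λ⟩ ∩ ℤ² = Λ`, where `⟨Λ⟩` is the real span of `Λ`. -/
def IsPrimitiveRankOne (Λ : AddSubgroup IntLattice) : Prop :=
  Module.finrank ℝ (Submodule.span ℝ (toPlane '' (Λ : Set IntLattice))) = 1 ∧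
    ∀ k : IntLattice, toPlane k ∈ Submodule.span ℝ (toPlane '' (Λ : Set IntLattice)) → k ∈ Λ

/-- `v` generates `Λ`, that is `ℤ v = Λ`. -/
def IsGenerator (v : IntLattice) (Λ : AddSubgroup IntLattice) : Prop :=
  AddSubgroup.zmultiples v = Λ

/-- A generator of `Λ` (for cyclic `Λ`; unique up to sign). -/
def gen (Λ : AddSubgroup IntLattice) : IntLattice :=
  Classical.epsilon fun v => IsGenerator v Λ

/-- The average `(1/L) ∫₀ᴸ f (x + s v^⊥ / L) ds` of `f` along the direction orthogonal to `Λ`,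
where `v` generates `Λ` and `L = ‖v‖`. -/
def latticeAverage (Λ : AddSubgroup IntLattice) (f : Torus → ℝ) (x : Torus) : ℝ :=
  ‖toPlane (gen Λ)‖⁻¹ * ∫ s in (0 : ℝ)..‖toPlane (gen Λ)‖,
    f (x + proj ((s / ‖toPlane (gen Λ)‖) • toPlane (rot (gen Λ))))

/-- The lattice `Λ^⊥ ∩ ℤ²` of integer vectors orthogonal to `Λ`. -/
def orthLattice (Λ : AddSubgroup IntLattice) : AddSubgroup IntLattice where
  carrier := {k | ∀ l ∈ Λ, k ⬝ᵥ l = 0}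
  zero_mem' := by intro l _; simp
  add_mem' := by
    intro a b ha hb l hl
    rw [add_dotProduct, ha l hl, hb l hl, add_zero]
  neg_mem' := by
    intro a ha l hl
    rw [neg_dotProduct, ha l hl, neg_zero]

/-- The rational unit vectors `v / ‖v‖`, `v` a generator of a primitive rank one sublattice. -/
def rationalDirections : Set Plane :=
  {w | ∃ (Λ : AddSubgroup IntLattice) (v : IntLattice),
    IsPrimitiveRankOne Λ ∧ IsGenerator v Λ ∧ w = ‖toPlane v‖⁻¹ • toPlane v}

/-- `∫_{𝕋²} exp (i ∫₀ᵗ I(V)(x + s ω v^⊥) ds) dx`, where `I(V)` is the average of `V` associated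
with the lattice `Λ^⊥ ∩ ℤ²` and `v` is a generator of `Λ`. -/
def transportIntegral (V : Torus → ℝ) (Λ : AddSubgroup IntLattice) (v : IntLattice)
    (ω t : ℝ) : ℂ :=
  ∫ x, Complex.exp (Complex.I *
    ((∫ s in (0 : ℝ)..t,
      latticeAverage (orthLattice Λ) V (x + proj ((s * ω) • toPlane (rot v))) : ℝ) : ℂ))
    ∂torusMeasure

end LoschmidtEcho

end

open LoschmidtEcho

/-!
The free evolution multiplies the data considered here by a phase, since all their plane waves
have the same energy (`IsSchrodingerSolution.eq_phase_smul`). The echo is therefore the squared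
modulus of `⟨ψ, u^ε(s)⟩`, a combination of one or two Fourier coefficients of `u^ε` at the wave
vectors of `ψ`.

Such a coefficient is computed by duality: instead of approximating `u^ε`, it is paired with an
approximate solution of the adjoint equation whose value at the final time is the plane wave. In
the time scale `h / ε` this approximate solution is, up to a phase, the plane wave `e_{-k}` times
`exp (-i Φ)`, where `Φ` solves the transport equation with source `V` and velocity
`c = 2 π h² k / ε`; at time zero it equals `∫₀ᵗ V (x + r c) dr`. What remains in the equation is
`h² / ε` times derivatives of the phase of order at most two, so that no hypothesis on the
direction of `k` is needed at this stage. In order to have explicit smooth phases and bounds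
uniform in `c`, `V` is replaced by a trigonometric polynomial close to it in the sup norm, so that
only the continuity of `V` enters. The remainder is integrated against `u^ε`, whose norm is
controlled by Grönwall's inequality (`IsSchrodingerSolution.norm_sq_le`). The outcome is
`exists_norm_coeff_sub_le`, and its limiting form `tendsto_coeff_sub_pair`.

It remains to find the uniform limit of `x ↦ ∫₀ᵗ V (x + r c) dr`. By density it is enough to treat
`V = e_q`, which is multiplied by `∫₀ᵗ exp (2 π i r q·c) dr`. This tends to zero if `|q·c| → ∞`, and
since `h / ε → ∞` that is the case if `q` is not orthogonal to the limit direction of `k`. For an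
irrational direction, only `q = 0` is orthogonal to it; for a rational one approached slowly,
`|q·c| → ∞` also for the orthogonal `q ≠ 0`. In both cases only `q = 0` survives
(`tendsto_lineIntegral_meanPhase`), the limiting phase is a real constant, and the echo tends to
one. At the critical rate the frequencies orthogonal to `v` survive and are transported with
velocity `ω v^⊥` (`tendsto_lineIntegral_resonantPhase`). For a superposition the interference
terms are Fourier coefficients, at the frequency `k - l`, of functions converging to a fixed
function, and they vanish in the limit because `k - l` leaves every finite set
(`tendsto_sub_cofinite`).
-/

open Filter Topology MeasureTheory

noncomputable section

namespace LoschmidtEcho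

/-! ### Characters and trigonometric polynomials -/

lemma proj_add (y z : Plane) : proj (y + z) = proj y + proj z := by
  funext i; simp [proj]

lemma isOpenQuotientMap_proj : IsOpenQuotientMap proj := by
  have h : IsOpenQuotientMap (Pi.map (fun (_ : Fin 2) (r : ℝ) => (r : UnitAddCircle))) :=
    IsOpenQuotientMap.piMap fun _ => QuotientAddGroup.isOpenQuotientMap_mk
  exact h.comp (EuclideanSpace.equiv (Fin 2) ℝ).toHomeomorph.isOpenQuotientMap

lemma continuous_proj : Continuous proj := isOpenQuotientMap_proj.continuous

/-- The pairing `y ↦ q · y` with a lattice vector, as a complex valued real linear form. -/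
def dotForm (q : IntLattice) : Plane →L[ℝ] ℂ :=
  Complex.ofRealCLM.comp (innerSL ℝ (toPlane q))

lemma dotForm_apply (q : IntLattice) (y : Plane) :
    dotForm q y = ((inner ℝ (toPlane q) y : ℝ) : ℂ) := rfl

lemma inner_toPlane (q : IntLattice) (y : Plane) :
    inner ℝ (toPlane q) y = q 0 * y 0 + q 1 * y 1 := by
  simp [toPlane, PiLp.inner_apply, Fin.sum_univ_two, mul_comm]

lemma mFourier_add_apply (q : IntLattice) (x y : Torus) :
    UnitAddTorus.mFourier q (x + y) = UnitAddTorus.mFourier q x * UnitAddTorus.mFourier q y := by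
  simp only [UnitAddTorus.mFourier, ContinuousMap.coe_mk, ← Finset.prod_mul_distrib]
  refine Finset.prod_congr rfl fun i _ => ?_
  simp [fourier_apply, smul_add, AddCircle.toCircle_add]

lemma mFourier_proj (q : IntLattice) (y : Plane) :
    UnitAddTorus.mFourier q (proj y) =
      Complex.exp (2 * Real.pi * Complex.I * dotForm q y) := by
  simp only [UnitAddTorus.mFourier, ContinuousMap.coe_mk, proj, fourier_coe_apply,
    Fin.prod_univ_two, dotForm_apply, inner_toPlane, ← Complex.exp_add]
  congr 1
  push_cast
  ring

/-- The trigonometric polynomial `∑ q ∈ S, a q * e_q`. -/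
def trigPoly (S : Finset IntLattice) (a : IntLattice → ℂ) : C(Torus, ℂ) :=
  ∑ q ∈ S, a q • UnitAddTorus.mFourier q

lemma trigPoly_apply (S : Finset IntLattice) (a : IntLattice → ℂ) (x : Torus) :
    trigPoly S a x = ∑ q ∈ S, a q * UnitAddTorus.mFourier q x := by
  simp [trigPoly, ContinuousMap.sum_apply]

lemma norm_trigPoly_le (S : Finset IntLattice) (a : IntLattice → ℂ) :
    ‖trigPoly S a‖ ≤ ∑ q ∈ S, ‖a q‖ := by
  refine (norm_sum_le _ _).trans_eq (Finset.sum_congr rfl fun q _ => ?_)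
  rw [norm_smul, UnitAddTorus.mFourier_norm, mul_one]

lemma exists_trigPoly_near (f : C(Torus, ℂ)) {δ : ℝ} (hδ : 0 < δ) :
    ∃ S a, ‖f - trigPoly S a‖ < δ := by
  have hf : f ∈ (Submodule.span ℂ (Set.range
      (UnitAddTorus.mFourier (d := Fin 2)))).topologicalClosure := by
    rw [UnitAddTorus.span_mFourier_closure_eq_top]; trivial
  obtain ⟨g, hg, hfg⟩ := Metric.mem_closure_iff.1 hf δ hδ
  obtain ⟨a, rfl⟩ := Finsupp.mem_span_range_iff_exists_finsupp.1 hg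
  exact ⟨a.support, a, by rwa [← dist_eq_norm]⟩

/-! ### The Laplacian of an exponential -/

/-- `Δ exp Ψ = exp Ψ * (Δ Ψ + ∇Ψ · ∇Ψ)` (bilinear square of the gradient). -/
lemma laplacian_cexp {Ψ : Plane → ℂ} {Ψ' : Plane → Plane →L[ℝ] ℂ}
    {Ψ'' : Plane →L[ℝ] Plane →L[ℝ] ℂ} {y : Plane} (h : ∀ z, HasFDerivAt Ψ (Ψ' z) z)
    (h2 : HasFDerivAt Ψ' Ψ'' y) :
    Laplacian.laplacian (fun z => Complex.exp (Ψ z)) y =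
      Complex.exp (Ψ y) * ∑ i : Fin 2,
        (Ψ'' (EuclideanSpace.single i 1) (EuclideanSpace.single i 1) +
          Ψ' y (EuclideanSpace.single i 1) ^ 2) := by
  rw [InnerProductSpace.laplacian_eq_iteratedFDeriv_orthonormalBasis _
    (EuclideanSpace.basisFun (Fin 2) ℝ), Finset.mul_sum]
  refine Finset.sum_congr rfl fun i _ => ?_
  have h1 : fderiv ℝ (fun z => Complex.exp (Ψ z)) = fun z => Complex.exp (Ψ z) • Ψ' z :=
    funext fun z => (h z).cexp.fderiv
  have h3 := ((h y).cexp.smul h2).fderiv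
  rw [iteratedFDeriv_two_apply, h1]
  change (fderiv ℝ ((fun z => Complex.exp (Ψ z)) • Ψ') y) _ _ = _
  rw [h3]
  simp
  ring

/-- The function `e_{-k} * exp g`; the sign is that of a test function paired bilinearly with a
solution concentrated near `e_k`. -/
def wave (k : IntLattice) (g : C(Torus, ℂ)) : C(Torus, ℂ) :=
  UnitAddTorus.mFourier (-k) * NormedSpace.exp g

lemma exp_apply (g : C(Torus, ℂ)) (x : Torus) : NormedSpace.exp g x = Complex.exp (g x) := by
  have := NormedSpace.map_exp (ContinuousMap.evalAlgHom ℂ ℂ x)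
    (ContinuousEvalConst.continuous_eval_const x) g
  rw [Complex.exp_eq_exp_ℂ]
  exact this

lemma wave_apply (k : IntLattice) (g : C(Torus, ℂ)) (x : Torus) :
    wave k g x = UnitAddTorus.mFourier (-k) x * Complex.exp (g x) := by
  rw [wave, ContinuousMap.mul_apply, exp_apply]

lemma norm_wave_le (k : IntLattice) (g : C(Torus, ℂ)) : ‖wave k g‖ ≤ Real.exp ‖g‖ := by
  refine (ContinuousMap.norm_le _ (Real.exp_pos _).le).2 fun x => ?_
  rw [wave_apply, norm_mul, Complex.norm_exp]
  have h1 := (UnitAddTorus.mFourier (-k)).norm_coe_le_norm x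
  rw [UnitAddTorus.mFourier_norm] at h1
  have h2 : (g x).re ≤ ‖g‖ := (Complex.re_le_norm _).trans (g.norm_coe_le_norm x)
  calc _ ≤ 1 * Real.exp ‖g‖ := by gcongr
    _ = _ := one_mul _

lemma wave_trigPoly_add_proj (k : IntLattice) (S : Finset IntLattice) (a : IntLattice → ℂ)
    (x : Torus) (y : Plane) :
    wave k (trigPoly S a) (x + proj y) = UnitAddTorus.mFourier (-k) x *
      Complex.exp (2 * Real.pi * Complex.I * dotForm (-k) y +
        ∑ q ∈ S, a q * UnitAddTorus.mFourier q x *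
          Complex.exp (2 * Real.pi * Complex.I * dotForm q y)) := by
  rw [wave_apply, mFourier_add_apply, mFourier_proj, trigPoly_apply, Complex.exp_add, mul_assoc]
  simp_rw [mFourier_add_apply, mFourier_proj, mul_assoc]

lemma isSmooth_wave (k : IntLattice) (S : Finset IntLattice) (a : IntLattice → ℂ) :
    IsSmooth (wave k (trigPoly S a)) := by
  have h : (fun y : Plane => wave k (trigPoly S a) (proj y)) = fun y =>
      UnitAddTorus.mFourier (-k) 0 *
      Complex.exp (2 * Real.pi * Complex.I * dotForm (-k) y +
        ∑ q ∈ S, a q * UnitAddTorus.mFourier q 0 *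
          Complex.exp (2 * Real.pi * Complex.I * dotForm q y)) := by
    funext y
    rw [← wave_trigPoly_add_proj, zero_add]
  rw [IsSmooth, h]
  fun_prop

/-- The partial derivative `∂ᵢ` of the trigonometric polynomial with coefficients `a`. -/
def trigDeriv (S : Finset IntLattice) (a : IntLattice → ℂ) (i : Fin 2) : C(Torus, ℂ) :=
  trigPoly S fun q => 2 * Real.pi * Complex.I * q i * a q

/-- The Laplacian of the trigonometric polynomial with coefficients `a`. -/
def trigLaplacian (S : Finset IntLattice) (a : IntLattice → ℂ) : C(Torus, ℂ) :=
  trigPoly S fun q => -(4 * Real.pi ^ 2 * ‖toPlane q‖ ^ 2) * a q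

lemma norm_toPlane_sq (q : IntLattice) : ‖toPlane q‖ ^ 2 = (q 0 : ℝ) ^ 2 + (q 1 : ℝ) ^ 2 := by
  simp [toPlane, EuclideanSpace.norm_sq_eq, Fin.sum_univ_two]

lemma torusLaplacian_wave (k : IntLattice) (S : Finset IntLattice) (a : IntLattice → ℂ)
    (x : Torus) :
    torusLaplacian (wave k (trigPoly S a)) x = wave k (trigPoly S a) x *
      (trigLaplacian S a x + ∑ i : Fin 2,
        (-(2 * Real.pi * Complex.I * k i) + trigDeriv S a i x) ^ 2) := by
  set b : IntLattice → ℂ := fun q => a q * UnitAddTorus.mFourier q x with hb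
  set C : ℂ := 2 * Real.pi * Complex.I with hC
  have hE : ∀ (q : IntLattice) (z : Plane), HasFDerivAt (fun y => Complex.exp (C * dotForm q y))
      ((Complex.exp (C * dotForm q z) * C) • dotForm q) z := fun q z => by
    rw [mul_smul]
    exact (((dotForm q).hasFDerivAt).const_mul C).cexp
  have h1 : ∀ z : Plane, HasFDerivAt (fun y => C * dotForm (-k) y +
        ∑ q ∈ S, b q * Complex.exp (C * dotForm q y))
      (C • dotForm (-k) + ∑ q ∈ S, (b q * C) • Complex.exp (C * dotForm q z) • dotForm q) z := by
    intro z
    refine (((dotForm (-k)).hasFDerivAt).const_mul C).add (HasFDerivAt.fun_sum fun q _ => ?_)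
    have := (hE q z).const_mul (b q)
    rwa [← mul_smul, mul_comm (Complex.exp _), ← mul_assoc, mul_smul] at this
  have h2 : HasFDerivAt (fun z => C • dotForm (-k) +
      ∑ q ∈ S, (b q * C) • Complex.exp (C * dotForm q z) • dotForm q)
      (∑ q ∈ S, (b q * C) • ((Complex.exp (C * dotForm q 0) * C) • dotForm q).smulRight
        (dotForm q)) (0 : Plane) := by
    refine HasFDerivAt.const_add _ (HasFDerivAt.fun_sum fun q _ => ?_)
    exact ((hE q 0).smul_const (dotForm q)).const_smul (b q * C)
  have hd : ∀ (q : IntLattice) (i : Fin 2),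
      dotForm q (EuclideanSpace.single i 1) = q i := by
    intro q i
    fin_cases i <;> simp [dotForm_apply, inner_toPlane]
  have hn : ∀ q : IntLattice, (‖toPlane q‖ : ℂ) ^ 2 = (q 0 : ℂ) ^ 2 + (q 1 : ℂ) ^ 2 := by
    intro q
    exact_mod_cast congrArg ((↑) : ℝ → ℂ) (norm_toPlane_sq q)
  have hfun : (fun y : Plane => wave k (trigPoly S a) (x + proj y)) = fun y =>
      UnitAddTorus.mFourier (-k) x • (fun y => Complex.exp (C * dotForm (-k) y +
        ∑ q ∈ S, b q * Complex.exp (C * dotForm q y))) y := by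
    funext y
    exact wave_trigPoly_add_proj k S a x y
  have hsm : ContDiff ℝ 2 (fun y => Complex.exp (C * dotForm (-k) y +
        ∑ q ∈ S, b q * Complex.exp (C * dotForm q y))) := by fun_prop
  rw [torusLaplacian, hfun]
  change Laplacian.laplacian (UnitAddTorus.mFourier (-k) x •
    (fun y => Complex.exp (C * dotForm (-k) y +
      ∑ q ∈ S, b q * Complex.exp (C * dotForm q y)))) 0 = _
  rw [InnerProductSpace.laplacian_smul _ hsm.contDiffAt, laplacian_cexp h1 h2, smul_eq_mul,
    ← mul_assoc]
  congr 1
  · rw [wave_apply, trigPoly_apply]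
    simp [hb]
  · rw [trigLaplacian, Finset.sum_add_distrib]
    congr 1
    · rw [trigPoly_apply]
      simp only [sum_apply, smul_apply,
        ContinuousLinearMap.smulRight_apply, hd, map_zero, mul_zero, Complex.exp_zero, one_mul,
        smul_eq_mul]
      rw [Finset.sum_comm]
      refine Finset.sum_congr rfl fun q _ => ?_
      rw [hn, Fin.sum_univ_two, hC]
      simp only [hb]
      linear_combination (4 * Real.pi ^ 2 * a q * UnitAddTorus.mFourier q x *
        ((q 0 : ℂ) ^ 2 + (q 1 : ℂ) ^ 2)) * Complex.I_sq
    · refine Finset.sum_congr rfl fun i _ => ?_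
      rw [trigDeriv, trigPoly_apply]
      simp only [add_apply, sum_apply,
        smul_apply, hd, map_zero, mul_zero, Complex.exp_zero, one_smul,
        smul_eq_mul, Pi.neg_apply, Int.cast_neg, mul_neg]
      congr 2
      refine Finset.sum_congr rfl fun q _ => ?_
      simp only [hb]
      ring

/-! ### The bilinear pairing and Fourier coefficients -/

/-- The class in `L²(𝕋²)` of a continuous function. -/
def toL2 : C(Torus, ℂ) →L[ℂ] L2Torus := ContinuousMap.toLp 2 torusMeasure ℂ

/-- The bilinear pairing `∫ φ u` of a continuous function with an element of `L²(𝕋²)`. -/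
def pair (φ : C(Torus, ℂ)) (u : L2Torus) : ℂ := ∫ x, φ x * u x ∂torusMeasure

lemma pair_eq_inner (φ : C(Torus, ℂ)) (u : L2Torus) :
    pair φ u = inner ℂ (toL2 (star φ)) u := by
  rw [MeasureTheory.L2.inner_def, pair]
  refine integral_congr_ae ?_
  filter_upwards [ContinuousMap.coeFn_toLp (p := 2) (𝕜 := ℂ) torusMeasure (star φ)] with x hx
  rw [toL2, hx]
  simp [RCLike.inner_apply, mul_comm]

lemma norm_toL2_le (φ : C(Torus, ℂ)) : ‖toL2 φ‖ ≤ ‖φ‖ := by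
  refine (Lp.norm_le_of_ae_bound (norm_nonneg φ) ?_).trans_eq ?_
  · filter_upwards [ContinuousMap.coeFn_toLp (p := 2) (𝕜 := ℂ) torusMeasure φ] with x hx
    rw [toL2, hx]
    exact φ.norm_coe_le_norm x
  · simp [measureUnivNNReal]

lemma norm_pair_le (φ : C(Torus, ℂ)) (u : L2Torus) : ‖pair φ u‖ ≤ ‖φ‖ * ‖u‖ := by
  rw [pair_eq_inner]
  refine (norm_inner_le_norm _ _).trans ?_
  gcongr
  exact (norm_toL2_le (star φ)).trans_eq (norm_star φ)

/-- `pair` as a continuous bilinear map. -/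
def pairL : C(Torus, ℂ) →L[ℂ] L2Torus →L[ℂ] ℂ :=
  LinearMap.mkContinuous₂
    (LinearMap.mk₂ ℂ pair
      (fun _ _ _ => by simp [pair_eq_inner, star_add, inner_add_left])
      (fun _ _ _ => by simp [pair_eq_inner, star_smul, inner_smul_left])
      (fun _ _ _ => by simp [pair_eq_inner, inner_add_right])
      (fun _ _ _ => by simp [pair_eq_inner, inner_smul_right]))
    1 (fun φ u => by simpa using norm_pair_le φ u)

lemma pairL_apply (φ : C(Torus, ℂ)) (u : L2Torus) : pairL φ u = pair φ u := rfl

lemma pair_toL2 (φ f : C(Torus, ℂ)) : pair φ (toL2 f) = ∫ x, φ x * f x ∂torusMeasure := by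
  refine integral_congr_ae ?_
  filter_upwards [ContinuousMap.coeFn_toLp (p := 2) (𝕜 := ℂ) torusMeasure f] with x hx
  rw [toL2, hx]

/-- Product rule for a test function moving differentiably in the sup norm and a weakly
differentiable, strongly continuous curve in `L²`. -/
lemma hasDerivAt_pair_comp {φ : ℝ → C(Torus, ℂ)} {φ' : C(Torus, ℂ)} {u : ℝ → L2Torus} {d : ℂ}
    {s : ℝ} (hφ : HasDerivAt φ φ' s) (hu : ContinuousAt u s)
    (hd : HasDerivAt (fun r => pair (φ s) (u r)) d s) :
    HasDerivAt (fun r => pair (φ r) (u r)) (pair φ' (u s) + d) s := by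
  rw [hasDerivAt_iff_tendsto_slope] at *
  have h1 : Tendsto (fun r => pairL (slope φ s r) (u r)) (𝓝[≠] s) (𝓝 (pairL φ' (u s))) :=
    (isBoundedBilinearMap_apply.continuous.tendsto (pairL φ', u s)).comp
      (((pairL.continuous.tendsto _).comp hφ).prodMk_nhds
        (hu.tendsto.mono_left nhdsWithin_le_nhds))
  refine (h1.add hd).congr fun r => ?_
  simp only [slope_def_module, ← pairL_apply]
  have h2 : pairL ((r - s)⁻¹ • (φ r - φ s)) = (r - s)⁻¹ • (pairL (φ r) - pairL (φ s)) := by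
    rw [← map_sub]
    exact (pairL.restrictScalars ℝ).map_smul _ _
  rw [h2]
  simp only [smul_sub, sub_apply, smul_apply]
  abel

lemma planeWave_eq (k : IntLattice) : planeWave k = toL2 (UnitAddTorus.mFourier k) := rfl

/-- The plane waves as a Hilbert basis of `L²(𝕋²)`. -/
def waveBasis : HilbertBasis IntLattice ℂ L2Torus := UnitAddTorus.mFourierBasis

lemma coe_waveBasis : ⇑waveBasis = planeWave := UnitAddTorus.coe_mFourierBasis

lemma star_mFourier (k : IntLattice) :
    star (UnitAddTorus.mFourier k) = UnitAddTorus.mFourier (-k) := by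
  ext x
  simp [UnitAddTorus.mFourier_neg]

lemma orthonormal_planeWave : Orthonormal ℂ planeWave :=
  coe_waveBasis ▸ waveBasis.orthonormal

/-- The Fourier coefficient `∫ e_{-k} u`. -/
def coeff (k : IntLattice) (u : L2Torus) : ℂ := pair (UnitAddTorus.mFourier (-k)) u

lemma coeff_eq_inner (k : IntLattice) (u : L2Torus) : coeff k u = inner ℂ (planeWave k) u := by
  rw [coeff, pair_eq_inner, star_mFourier, neg_neg, planeWave_eq]

lemma coeff_planeWave (k l : IntLattice) : coeff k (planeWave l) = if k = l then 1 else 0 := by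
  rw [coeff_eq_inner, orthonormal_iff_ite.1 orthonormal_planeWave]

lemma ext_coeff {u v : L2Torus} (h : ∀ k, coeff k u = coeff k v) : u = v := by
  refine waveBasis.repr.injective (lp.ext (funext fun k => ?_))
  simpa [HilbertBasis.repr_apply_apply, coe_waveBasis, ← coeff_eq_inner] using h k

lemma hasSum_norm_coeff_sq (u : L2Torus) : HasSum (fun k => ‖coeff k u‖ ^ 2) (‖u‖ ^ 2) := by
  have h := Complex.hasSum_re (waveBasis.hasSum_inner_mul_inner u u)
  rw [inner_self_eq_norm_sq_to_K] at h
  convert h using 1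
  · funext k
    rw [coe_waveBasis, ← coeff_eq_inner, ← inner_conj_symm, ← coeff_eq_inner, Complex.conj_mul']
    norm_cast
  · norm_cast

lemma sum_norm_coeff_sq_le (S : Finset IntLattice) (u : L2Torus) :
    ∑ k ∈ S, ‖coeff k u‖ ^ 2 ≤ ‖u‖ ^ 2 :=
  sum_le_hasSum S (fun _ _ => by positivity) (hasSum_norm_coeff_sq u)

lemma tendsto_coeff_cofinite (u : L2Torus) : Tendsto (fun k => coeff k u) cofinite (𝓝 0) := by
  have h := (hasSum_norm_coeff_sq u).summable.tendsto_cofinite_zero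
  rw [tendsto_zero_iff_norm_tendsto_zero]
  have h2 := h.sqrt
  simpa using h2

/-- Multiplying the projection of `u` on finitely many plane waves by `W` and pairing with `u`
costs at most the sup norm of `W`, by Bessel's inequality. -/
lemma norm_sum_conj_coeff_mul_le (S : Finset IntLattice) (W : C(Torus, ℂ)) (u : L2Torus) :
    ‖∑ k ∈ S, (starRingEnd ℂ) (coeff k u) * pair (UnitAddTorus.mFourier (-k) * W) u‖ ≤
      ‖W‖ * ‖u‖ ^ 2 := by
  set φ : C(Torus, ℂ) := ∑ k ∈ S, coeff k u • UnitAddTorus.mFourier k with hφ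
  have h1 : ∑ k ∈ S, (starRingEnd ℂ) (coeff k u) * pair (UnitAddTorus.mFourier (-k) * W) u =
      pair (star φ * W) u := by
    rw [hφ, star_sum, Finset.sum_mul, ← pairL_apply, map_sum, sum_apply]
    refine Finset.sum_congr rfl fun k _ => ?_
    rw [star_smul, star_mFourier, smul_mul_assoc, map_smul, smul_apply, pairL_apply]
    rfl
  have h2 : ‖toL2 φ‖ ≤ ‖u‖ := by
    have h3 : ‖toL2 φ‖ ^ 2 = ∑ k ∈ S, ‖coeff k u‖ ^ 2 := by
      have h4 : toL2 φ = ∑ k ∈ S, coeff k u • planeWave k := by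
        simp [hφ, map_sum, planeWave_eq]
      have h5 := orthonormal_planeWave.inner_sum (fun k => coeff k u) (fun k => coeff k u) S
      rw [← h4, inner_self_eq_norm_sq_to_K] at h5
      simp only [Complex.conj_mul'] at h5
      exact Complex.ofReal_injective (by push_cast; exact h5)
    exact (sq_le_sq₀ (norm_nonneg _) (norm_nonneg _)).1
      (h3.trans_le (sum_norm_coeff_sq_le S u))
  have h3 : ‖toL2 (star (star φ * W))‖ ≤ ‖W‖ * ‖toL2 φ‖ := by
    refine Lp.norm_le_mul_norm_of_ae_le_mul ?_
    filter_upwards [ContinuousMap.coeFn_toLp (p := 2) (𝕜 := ℂ) torusMeasure (star (star φ * W)),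
      ContinuousMap.coeFn_toLp (p := 2) (𝕜 := ℂ) torusMeasure φ] with x hx hx'
    rw [toL2, hx, hx']
    simp only [star_mul, star_star, ContinuousMap.mul_apply, ContinuousMap.star_apply, norm_mul,
      norm_star]
    gcongr
    exact W.norm_coe_le_norm x
  rw [h1, pair_eq_inner]
  calc _ ≤ ‖toL2 (star (star φ * W))‖ * ‖u‖ := norm_inner_le_norm _ _
    _ ≤ (‖W‖ * ‖u‖) * ‖u‖ := by
      gcongr
      exact h3.trans (by gcongr)
    _ = _ := by ring

/-! ### Evolution of Fourier coefficients -/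

section Evolution

variable {h : ℝ} {W : Torus → ℝ} {ψ : L2Torus} {u : ℝ → L2Torus}

lemma IsSchrodingerSolution.hasDerivAt_pair (hu : IsSchrodingerSolution h W ψ u) (hh : h ≠ 0)
    {φ χ : C(Torus, ℂ)} (hφ : IsSmooth φ)
    (hχ : ∀ x, χ x = -((h : ℂ) ^ 2 / 2) * torusLaplacian φ x + (W x : ℂ) * φ x) (s : ℝ) :
    HasDerivAt (fun r => pair φ (u r)) (-(Complex.I / h) * pair χ (u s)) s := by
  obtain ⟨d, hd, he⟩ := hu.equation φ hφ s
  simp_rw [← hχ] at he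
  have : d = -(Complex.I / h) * pair χ (u s) := by
    have hh' : (h : ℂ) ≠ 0 := by exact_mod_cast hh
    rw [pair, ← he]
    field_simp
    linear_combination d * Complex.I_sq
  exact this ▸ hd

lemma wave_zero (k : IntLattice) : wave k (trigPoly ∅ 0) = UnitAddTorus.mFourier (-k) := by
  simp [wave, trigPoly]

/-- The frequency `2 π² h ‖k‖²` of the free evolution of the plane wave `e_k`. -/
def freq (h : ℝ) (k : IntLattice) : ℝ := 2 * Real.pi ^ 2 * h * ‖toPlane k‖ ^ 2

lemma torusLaplacian_mFourier_neg (k : IntLattice) (x : Torus) :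
    torusLaplacian (UnitAddTorus.mFourier (-k)) x =
      -(4 * Real.pi ^ 2 * ‖toPlane k‖ ^ 2) * UnitAddTorus.mFourier (-k) x := by
  have hn : (‖toPlane k‖ : ℂ) ^ 2 = (k 0 : ℂ) ^ 2 + (k 1 : ℂ) ^ 2 := by
    exact_mod_cast congrArg ((↑) : ℝ → ℂ) (norm_toPlane_sq k)
  rw [← wave_zero, torusLaplacian_wave, hn]
  simp only [trigLaplacian, trigDeriv, trigPoly_apply, Finset.sum_empty, Fin.sum_univ_two]
  linear_combination (4 * Real.pi ^ 2 * ((k 0 : ℂ) ^ 2 + (k 1 : ℂ) ^ 2) *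
    wave k (trigPoly ∅ 0) x) * Complex.I_sq

lemma IsSchrodingerSolution.hasDerivAt_coeff (hu : IsSchrodingerSolution h W ψ u) (hh : h ≠ 0)
    {Wc : C(Torus, ℂ)} (hW : ∀ x, Wc x = W x) (k : IntLattice) (s : ℝ) :
    HasDerivAt (fun r => coeff k (u r))
      (-(Complex.I * freq h k) * coeff k (u s) -
        Complex.I / h * pair (UnitAddTorus.mFourier (-k) * Wc) (u s)) s := by
  have hs : IsSmooth (UnitAddTorus.mFourier (-k)) := wave_zero k ▸ isSmooth_wave k ∅ 0
  have := hu.hasDerivAt_pair hh hs (χ := (h * freq h k : ℂ) • UnitAddTorus.mFourier (-k) +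
    UnitAddTorus.mFourier (-k) * Wc) (fun x => by
      rw [torusLaplacian_mFourier_neg]
      simp [hW, freq]
      ring) s
  refine this.congr_deriv ?_
  have hh' : (h : ℂ) ≠ 0 := by exact_mod_cast hh
  rw [← pairL_apply (_ + _), map_add, map_smul, add_apply, smul_apply, pairL_apply, pairL_apply,
    coeff, smul_eq_mul]
  field_simp
  ring

/-- The free evolution of an initial datum whose frequencies all agree is a phase factor. -/
lemma IsSchrodingerSolution.eq_phase_smul (hu : IsSchrodingerSolution h (fun _ => 0) ψ u)
    (hh : h ≠ 0) {ν : ℝ} (hν : ∀ k, coeff k ψ ≠ 0 → freq h k = ν) (s : ℝ) :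
    u s = Complex.exp (-(Complex.I * ν * s)) • ψ := by
  refine ext_coeff fun k => ?_
  have hd : ∀ r : ℝ, HasDerivAt
      (fun r : ℝ => coeff k (u r) * Complex.exp (Complex.I * freq h k * r)) 0 r := by
    intro r
    have h1 := hu.hasDerivAt_coeff hh (Wc := 0) (by simp) k r
    have h2 : HasDerivAt (fun r : ℝ => Complex.exp (Complex.I * freq h k * r))
        (Complex.exp (Complex.I * freq h k * r) * (Complex.I * freq h k * 1)) r :=
      (((hasDerivAt_id r).ofReal_comp).const_mul (Complex.I * (freq h k : ℂ))).cexp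
    refine (h1.mul h2).congr_deriv ?_
    simp only [mul_zero, ← pairL_apply, map_zero, zero_apply]
    ring
  have hc := is_const_of_deriv_eq_zero (fun r => (hd r).differentiableAt)
    (fun r => (hd r).deriv) s 0
  simp only [hu.initial, Complex.ofReal_zero, mul_zero, Complex.exp_zero, mul_one] at hc
  have hc' : coeff k (u s) = Complex.exp (-(Complex.I * freq h k * s)) * coeff k ψ := by
    rw [← hc, mul_comm, mul_assoc, ← Complex.exp_add, add_neg_cancel, Complex.exp_zero, mul_one]
  rw [hc']
  have hsm : coeff k (Complex.exp (-(Complex.I * ν * s)) • ψ) =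
      Complex.exp (-(Complex.I * ν * s)) * coeff k ψ := by
    simp [coeff_eq_inner, inner_smul_right]
  rw [hsm]
  by_cases h0 : coeff k ψ = 0
  · simp [h0]
  · rw [hν k h0]

/-- The free part of the equation rotates each Fourier coefficient, so only the potential
contributes to the growth of partial sums of their squared moduli. -/
lemma IsSchrodingerSolution.hasDerivAt_sum_norm_sq (hu : IsSchrodingerSolution h W ψ u)
    (hh : 0 < h) {Wc : C(Torus, ℂ)} (hW : ∀ x, Wc x = W x) (S : Finset IntLattice) (s : ℝ) :
    ∃ d : ℝ, HasDerivAt (fun r => ∑ k ∈ S, ‖coeff k (u r)‖ ^ 2) d s ∧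
      |d| ≤ 2 * ‖Wc‖ / h * ‖u s‖ ^ 2 := by
  set b : IntLattice → ℂ := fun k => pair (UnitAddTorus.mFourier (-k) * Wc) (u s) with hb
  refine ⟨2 / h * (∑ k ∈ S, (starRingEnd ℂ) (coeff k (u s)) * b k).im, ?_, ?_⟩
  · rw [Complex.im_sum, Finset.mul_sum]
    refine HasDerivAt.fun_sum fun k _ => ?_
    refine (hu.hasDerivAt_coeff hh.ne' hW k s).norm_sq.congr_deriv ?_
    rw [Complex.inner]
    simp [hb, Complex.div_re, Complex.div_im]
    field_simp
    ring
  · rw [abs_mul, abs_of_pos (by positivity)]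
    calc _ ≤ 2 / h * (‖Wc‖ * ‖u s‖ ^ 2) := by
          gcongr
          exact (Complex.abs_im_le_norm _).trans (norm_sum_conj_coeff_mul_le S Wc (u s))
      _ = _ := by ring

/-- A priori bound: Grönwall's inequality for the squared norm, which is the supremum of the
finite sums of squares of Fourier coefficients. -/
lemma IsSchrodingerSolution.norm_sq_le (hu : IsSchrodingerSolution h W ψ u)
    (hh : 0 < h) {Wc : C(Torus, ℂ)} (hW : ∀ x, Wc x = W x) (τ : ℝ) :
    ‖u τ‖ ^ 2 ≤ ‖ψ‖ ^ 2 * Real.exp (2 * ‖Wc‖ / h * |τ|) := by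
  -- the time interval is rescaled to `[0, 1]`, so that `τ` may have any sign
  set K : ℝ := 2 * ‖Wc‖ / h * |τ| with hK
  have hK0 : 0 ≤ K := by positivity
  have hg : Continuous fun r : ℝ => ‖u (τ * r)‖ ^ 2 :=
    (hu.continuous.comp (continuous_const.mul continuous_id)).norm.pow 2
  set G : ℝ → ℝ := fun σ => ‖ψ‖ ^ 2 + K * ∫ r in (0 : ℝ)..σ, ‖u (τ * r)‖ ^ 2 with hG
  have hGd : ∀ σ, HasDerivAt G (K * ‖u (τ * σ)‖ ^ 2) σ := fun σ =>
    ((hg.integral_hasStrictDerivAt 0 σ).hasDerivAt.const_mul K).const_add _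
  have hG0 : G 0 = ‖ψ‖ ^ 2 := by simp [hG]
  have hle : ∀ σ, 0 ≤ σ → ‖u (τ * σ)‖ ^ 2 ≤ G σ := by
    intro σ hσ
    refine hasSum_le_of_sum_le (hasSum_norm_coeff_sq _) fun S => ?_
    choose d hd hdle using fun s => hu.hasDerivAt_sum_norm_sq hh hW S s
    have hmono : Monotone fun σ => G σ - ∑ k ∈ S, ‖coeff k (u (τ * σ))‖ ^ 2 := by
      have hD : ∀ σ, HasDerivAt (fun σ => G σ - ∑ k ∈ S, ‖coeff k (u (τ * σ))‖ ^ 2)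
          (K * ‖u (τ * σ)‖ ^ 2 - d (τ * σ) * τ) σ := fun σ =>
        (hGd σ).sub ((hd (τ * σ)).comp σ (by simpa using (hasDerivAt_id σ).const_mul τ))
      refine monotone_of_deriv_nonneg (fun σ => (hD σ).differentiableAt) fun σ => ?_
      rw [(hD σ).deriv, sub_nonneg]
      calc d (τ * σ) * τ ≤ |d (τ * σ)| * |τ| := by rw [← abs_mul]; exact le_abs_self _
        _ ≤ (2 * ‖Wc‖ / h * ‖u (τ * σ)‖ ^ 2) * |τ| := by gcongr; exact hdle _
        _ = _ := by rw [hK]; ring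
    have := hmono hσ
    simp only [mul_zero, hu.initial, hG0] at this
    linarith [sum_norm_coeff_sq_le S ψ]
  have hanti : AntitoneOn (fun σ => G σ * Real.exp (-(K * σ))) (Set.Ici 0) := by
    have hD : ∀ σ, HasDerivAt (fun σ => G σ * Real.exp (-(K * σ)))
        (K * ‖u (τ * σ)‖ ^ 2 * Real.exp (-(K * σ)) + G σ * (Real.exp (-(K * σ)) * (-(K * 1)))) σ :=
      fun σ => (hGd σ).mul ((((hasDerivAt_id σ).const_mul K).neg).exp)
    refine antitoneOn_of_deriv_nonpos (convex_Ici 0)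
      (fun σ _ => (hD σ).continuousAt.continuousWithinAt)
      (fun σ _ => (hD σ).differentiableAt.differentiableWithinAt) fun σ hσ => ?_
    rw [interior_Ici] at hσ
    rw [(hD σ).deriv]
    have := mul_le_mul_of_nonneg_left (hle σ (le_of_lt hσ))
      (mul_nonneg hK0 (Real.exp_pos (-(K * σ))).le)
    linarith
  have h1 := hanti (Set.mem_Ici.2 le_rfl) (Set.mem_Ici.2 zero_le_one) zero_le_one
  simp only [hG0, mul_one, mul_zero, neg_zero, Real.exp_zero] at h1
  have h2 := hle 1 zero_le_one
  rw [mul_one] at h2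
  rw [Real.exp_neg, ← div_eq_mul_inv, div_le_iff₀ (Real.exp_pos _)] at h1
  exact h2.trans h1

end Evolution

/-! ### Integrals along line segments of the torus -/

/-- The translate `x ↦ f (x + y)`. -/
def shift (y : Plane) (f : C(Torus, ℂ)) : C(Torus, ℂ) :=
  f.comp ⟨fun x => x + proj y, by fun_prop⟩

lemma shift_apply (y : Plane) (f : C(Torus, ℂ)) (x : Torus) : shift y f x = f (x + proj y) := rfl

lemma continuous_shift (f : C(Torus, ℂ)) : Continuous fun y => shift y f := by
  refine ContinuousMap.continuous_of_continuous_uncurry _ ?_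
  have := continuous_proj
  change Continuous fun z : Plane × Torus => f (z.2 + proj z.1)
  fun_prop

lemma continuous_shift_smul (y : Plane) (f : C(Torus, ℂ)) :
    Continuous fun r : ℝ => shift (r • y) f :=
  (continuous_shift f).comp (by fun_prop)

/-- The integral `x ↦ ∫₀ᵃ f (x + r y) dr` along a segment, as a continuous function. -/
def lineIntegral (y : Plane) (a : ℝ) (f : C(Torus, ℂ)) : C(Torus, ℂ) :=
  ∫ r in (0 : ℝ)..a, shift (r • y) f

lemma lineIntegral_apply (y : Plane) (a : ℝ) (f : C(Torus, ℂ)) (x : Torus) :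
    lineIntegral y a f x = ∫ r in (0 : ℝ)..a, f (x + proj (r • y)) := by
  have := (ContinuousMap.evalCLM ℂ (M := ℂ) x).intervalIntegral_comp_comm
    ((continuous_shift_smul y f).intervalIntegrable (μ := volume) 0 a)
  exact this.symm

lemma lineIntegral_sub (y : Plane) (a : ℝ) (f g : C(Torus, ℂ)) :
    lineIntegral y a (f - g) = lineIntegral y a f - lineIntegral y a g :=
  intervalIntegral.integral_sub ((continuous_shift_smul y f).intervalIntegrable 0 a)
    ((continuous_shift_smul y g).intervalIntegrable 0 a)

lemma norm_lineIntegral_le (y : Plane) (a : ℝ) (f : C(Torus, ℂ)) :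
    ‖lineIntegral y a f‖ ≤ |a| * ‖f‖ := by
  have := intervalIntegral.norm_integral_le_of_norm_le_const (a := 0) (b := a) (C := ‖f‖)
    (f := fun r : ℝ => shift (r • y) f) fun r _ =>
    (ContinuousMap.norm_le _ (norm_nonneg f)).2 fun x => f.norm_coe_le_norm _
  rwa [sub_zero, mul_comm] at this

/-- The oscillatory integral `∫₀ᵃ exp (2 π i r z) dr`. -/
def oscInt (a z : ℝ) : ℂ := ∫ r in (0 : ℝ)..a, Complex.exp (2 * Real.pi * Complex.I * (r * z))

lemma hasDerivAt_oscInt (a z : ℝ) :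
    HasDerivAt (fun a => oscInt a z) (Complex.exp (2 * Real.pi * Complex.I * (a * z))) a :=
  (Continuous.integral_hasStrictDerivAt (by fun_prop) 0 a).hasDerivAt

lemma exp_eq_oscInt (a z : ℝ) : Complex.exp (2 * Real.pi * Complex.I * (a * z)) =
    1 + 2 * Real.pi * Complex.I * z * oscInt a z := by
  have h : ∀ r : ℝ, HasDerivAt (fun r : ℝ => Complex.exp (2 * Real.pi * Complex.I * (r * z)))
      (2 * Real.pi * Complex.I * z * Complex.exp (2 * Real.pi * Complex.I * (r * z))) r := by
    intro r
    have h1 := (((hasDerivAt_id r).ofReal_comp.mul_const (z : ℂ)).const_mul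
      (2 * Real.pi * Complex.I)).cexp
    refine h1.congr_deriv ?_
    simp
    ring
  have h2 := intervalIntegral.integral_eq_sub_of_hasDerivAt (a := 0) (b := a) (fun r _ => h r)
    (Continuous.intervalIntegrable (by fun_prop) _ _)
  rw [intervalIntegral.integral_const_mul] at h2
  rw [oscInt, h2]
  simp

lemma norm_exp_two_pi_I (r : ℝ) : ‖Complex.exp (2 * Real.pi * Complex.I * r)‖ = 1 := by
  have : (2 * Real.pi * Complex.I * r : ℂ) = ((2 * Real.pi * r : ℝ) : ℂ) * Complex.I := by
    push_cast; ring
  rw [this, Complex.norm_exp_ofReal_mul_I]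

lemma norm_oscInt_le (a z : ℝ) : ‖oscInt a z‖ ≤ |a| := by
  have := intervalIntegral.norm_integral_le_of_norm_le_const (a := 0) (b := a) (C := 1)
    (f := fun r : ℝ => Complex.exp (2 * Real.pi * Complex.I * (r * z))) fun r _ => by
      rw [← Complex.ofReal_mul, norm_exp_two_pi_I]
  rwa [sub_zero, one_mul] at this

lemma norm_oscInt_mul_le (a z : ℝ) : |z| * ‖oscInt a z‖ ≤ 1 := by
  have h : ‖2 * Real.pi * Complex.I * z * oscInt a z‖ ≤ 2 := by
    rw [← sub_eq_of_eq_add' (exp_eq_oscInt a z), ← Complex.ofReal_mul]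
    refine (norm_sub_le _ _).trans ?_
    rw [norm_exp_two_pi_I, norm_one]
    norm_num
  simp only [norm_mul, Complex.norm_ofNat, Complex.norm_real, Complex.norm_I, Real.norm_eq_abs,
    abs_of_pos Real.pi_pos, mul_assoc] at h
  nlinarith [Real.pi_gt_three, mul_nonneg (abs_nonneg z) (norm_nonneg (oscInt a z))]

lemma oscInt_zero (a : ℝ) : oscInt a 0 = a := by simp [oscInt]

lemma continuous_oscInt (a : ℝ) : Continuous (oscInt a) :=
  intervalIntegral.continuous_parametric_intervalIntegral_of_continuous' (by fun_prop) 0 a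

lemma lineIntegral_mFourier (y : Plane) (a : ℝ) (q : IntLattice) :
    lineIntegral y a (UnitAddTorus.mFourier q) =
      oscInt a (inner ℝ (toPlane q) y) • UnitAddTorus.mFourier q := by
  ext x
  rw [lineIntegral_apply, ContinuousMap.smul_apply, smul_eq_mul, oscInt,
    ← intervalIntegral.integral_mul_const]
  refine intervalIntegral.integral_congr fun r _ => ?_
  simp only [mFourier_add_apply, mFourier_proj, dotForm_apply, inner_smul_right]
  push_cast
  ring

lemma lineIntegral_trigPoly (y : Plane) (a : ℝ) (S : Finset IntLattice) (p : IntLattice → ℂ) :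
    lineIntegral y a (trigPoly S p) =
      trigPoly S fun q => p q * oscInt a (inner ℝ (toPlane q) y) := by
  have h : ∀ r : ℝ, shift (r • y) (trigPoly S p) =
      ∑ q ∈ S, p q • shift (r • y) (UnitAddTorus.mFourier q) := by
    intro r
    ext x
    simp [shift_apply, trigPoly_apply, ContinuousMap.sum_apply]
  simp only [lineIntegral, h]
  have hi : ∀ q ∈ S, IntervalIntegrable
      (fun r : ℝ => p q • shift (r • y) (UnitAddTorus.mFourier q)) volume 0 a := fun q _ =>
    ((continuous_shift_smul y _).const_smul (p q)).intervalIntegrable 0 a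
  rw [intervalIntegral.integral_finsetSum hi, trigPoly]
  refine Finset.sum_congr rfl fun q _ => ?_
  rw [intervalIntegral.integral_smul, mul_smul, ← lineIntegral_mFourier]
  rfl

/-! ### The approximate solution -/

lemma hasDerivAt_trigPoly {S : Finset IntLattice} {a : ℝ → IntLattice → ℂ} {a' : IntLattice → ℂ}
    {s : ℝ} (h : ∀ q, HasDerivAt (fun r => a r q) (a' q) s) :
    HasDerivAt (fun r => trigPoly S (a r)) (trigPoly S a') s :=
  HasDerivAt.fun_sum fun q _ =>
    ((ContinuousLinearMap.toSpanSingleton ℂ (UnitAddTorus.mFourier q)).restrictScalars ℝ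
      ).hasFDerivAt.comp_hasDerivAt s (h q)

lemma hasDerivAt_wave {g : ℝ → C(Torus, ℂ)} {g' : C(Torus, ℂ)} {s : ℝ} (k : IntLattice)
    (h : HasDerivAt g g' s) : HasDerivAt (fun r => wave k (g r)) (wave k (g s) * g') s := by
  have h1 : HasFDerivAt (NormedSpace.exp : C(Torus, ℂ) → C(Torus, ℂ))
      (NormedSpace.exp (g s) • (1 : C(Torus, ℂ) →L[ℝ] C(Torus, ℂ))) (g s) := hasFDerivAt_exp
  have h2 := (h1.comp_hasDerivAt s h).const_mul (UnitAddTorus.mFourier (-k))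
  refine h2.congr_deriv ?_
  simp [wave, mul_assoc]

/-- The part `Δ g + ∇g · ∇g` of the Laplacian of `exp g` is bounded uniformly over the
trigonometric polynomials `g` with coefficients dominated by `T * |p|`. -/
lemma exists_bound_trigDeriv (S : Finset IntLattice) (p : IntLattice → ℂ) (T : ℝ) :
    ∃ C : ℝ, 0 ≤ C ∧ ∀ a : IntLattice → ℂ, (∀ q, ‖a q‖ ≤ T * ‖p q‖) →
      ‖trigLaplacian S a + ∑ i : Fin 2, trigDeriv S a i ^ 2‖ ≤ C := by
  set L : ℝ := ∑ q ∈ S, ‖(-(4 * Real.pi ^ 2 * ‖toPlane q‖ ^ 2) : ℂ)‖ * (T * ‖p q‖)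
  set D : Fin 2 → ℝ := fun i => ∑ q ∈ S, ‖(2 * Real.pi * Complex.I * q i : ℂ)‖ * (T * ‖p q‖)
  refine ⟨|L + ∑ i, D i ^ 2|, abs_nonneg _, fun a ha => le_trans ?_ (le_abs_self _)⟩
  refine (norm_add_le _ _).trans (add_le_add ?_ ((norm_sum_le _ _).trans
    (Finset.sum_le_sum fun i _ => (norm_pow_le _ 2).trans ?_)))
  · refine (norm_trigPoly_le _ _).trans (Finset.sum_le_sum fun q _ => ?_)
    rw [norm_mul]
    gcongr
    exact ha q
  · gcongr
    refine (norm_trigPoly_le _ _).trans (Finset.sum_le_sum fun q _ => ?_)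
    rw [norm_mul]
    gcongr
    exact ha q

/-- The velocity, in the time scale `h / ε`, of the free classical motion of momentum `h k`. -/
def velocity (h ε : ℝ) (k : IntLattice) : Plane := (2 * Real.pi * h ^ 2 / ε) • toPlane k

lemma inner_velocity (h ε : ℝ) (k q : IntLattice) : inner ℝ (toPlane q) (velocity h ε k) =
    2 * Real.pi * h ^ 2 / ε * (q 0 * k 0 + q 1 * k 1) := by
  rw [velocity, inner_smul_right, inner_toPlane]
  simp [toPlane]

/-- The phase `-i ∫₀^{t-σ} P (x + r c) dr` of the approximate solution has as `σ` derivative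
`i P` minus the transport term. -/
lemma transport_identity {h ε : ℝ} (k : IntLattice) (S : Finset IntLattice)
    (p : IntLattice → ℂ) (s : ℝ) (x : Torus) :
    trigPoly S (fun q => Complex.I * (p q * Complex.exp (2 * Real.pi * Complex.I *
      (s * (inner ℝ (toPlane q) (velocity h ε k) : ℝ))))) x =
    Complex.I * trigPoly S p x - 2 * Real.pi * h ^ 2 / ε * ∑ i : Fin 2, k i *
      trigDeriv S (fun q => -Complex.I * (p q * oscInt s (inner ℝ (toPlane q) (velocity h ε k))))
        i x := by
  simp only [trigDeriv, trigPoly_apply, Finset.mul_sum, Fin.sum_univ_two, mul_add]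
  rw [← Finset.sum_add_distrib, ← Finset.sum_sub_distrib]
  refine Finset.sum_congr rfl fun q _ => ?_
  rw [exp_eq_oscInt, inner_velocity]
  push_cast
  ring

/-- The equation satisfied by `σ ↦ ∫ φ_σ u (σ h / ε)` for the approximate solution `φ_σ`: all terms
of order one cancel, and only the error of the potential and a term with factor `h² / ε` remain. -/
lemma hasDerivAt_pair_wave {V : Torus → ℝ} {Vc : C(Torus, ℂ)} (hV : ∀ x, Vc x = V x) {h ε : ℝ}
    (hh : 0 < h) (hε : 0 < ε) {ψ : L2Torus} {u : ℝ → L2Torus}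
    (hu : IsSchrodingerSolution h (fun x => ε * V x) ψ u) (k : IntLattice)
    (S : Finset IntLattice) (p : IntLattice → ℂ) (t s : ℝ) (a : ℝ → IntLattice → ℂ)
    (ha : ∀ r q, a r q =
      -Complex.I * (p q * oscInt (t - r) (inner ℝ (toPlane q) (velocity h ε k)))) :
    HasDerivAt (fun r : ℝ => Complex.exp (Complex.I * freq h k * (r * (h / ε) : ℝ)) *
        pair (wave k (trigPoly S (a r))) (u (r * (h / ε))))
      (Complex.exp (Complex.I * freq h k * (s * (h / ε) : ℝ)) *
        pair (wave k (trigPoly S (a s)) * (Complex.I • (trigPoly S p - Vc) +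
          (Complex.I * (h ^ 2 / ε / 2 : ℝ)) • (trigLaplacian S (a s) +
            ∑ i : Fin 2, trigDeriv S (a s) i ^ 2))) (u (s * (h / ε)))) s := by
  set c := velocity h ε k with hc
  set a' : IntLattice → ℂ := fun q => Complex.I * (p q * Complex.exp (2 * Real.pi * Complex.I *
      ((t - s : ℝ) * (inner ℝ (toPlane q) c : ℝ)))) with ha'
  have hda : ∀ q, HasDerivAt (fun r => a r q) (a' q) s := by
    intro q
    simp only [ha]
    have h1 := (hasDerivAt_oscInt (t - s) (inner ℝ (toPlane q) c)).scomp s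
      ((hasDerivAt_id s).const_sub t)
    refine ((h1.const_mul (p q)).const_mul (-Complex.I)).congr_deriv ?_
    simp [ha']
  have hwave := hasDerivAt_wave k (hasDerivAt_trigPoly (S := S) hda)
  set φ : C(Torus, ℂ) := wave k (trigPoly S (a s)) with hφ
  set A : C(Torus, ℂ) := trigLaplacian S (a s) +
    ∑ i : Fin 2, (-(2 * Real.pi * Complex.I * k i) • 1 + trigDeriv S (a s) i) ^ 2 with hA
  set χ : C(Torus, ℂ) := φ * (-((h : ℂ) ^ 2 / 2) • A + (ε : ℂ) • Vc) with hχ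
  have hχe : ∀ x, χ x =
      -((h : ℂ) ^ 2 / 2) * torusLaplacian φ x + ((ε * V x : ℝ) : ℂ) * φ x := by
    intro x
    rw [hφ, torusLaplacian_wave, ← hφ]
    simp [hχ, hA, ← hV]
    ring
  have hpair := (hu.hasDerivAt_pair hh.ne' (isSmooth_wave k S (a s)) hχe
    (s * (h / ε))).scomp s ((hasDerivAt_id s).mul_const (h / ε))
  have hcont : ContinuousAt (fun r => u (r * (h / ε))) s :=
    (hu.continuous.comp (continuous_id.mul continuous_const)).continuousAt
  have hbil := hasDerivAt_pair_comp hwave hcont hpair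
  have hphase : HasDerivAt
      (fun r : ℝ => Complex.exp (Complex.I * freq h k * (r * (h / ε) : ℝ)))
      (Complex.exp (Complex.I * freq h k * (s * (h / ε) : ℝ)) *
        (Complex.I * freq h k * (1 * (h / ε) : ℝ))) s :=
    ((((hasDerivAt_id s).mul_const (h / ε)).ofReal_comp).const_mul
      (Complex.I * (freq h k : ℂ))).cexp
  refine (hphase.mul hbil).congr_deriv ?_
  have hε' : (ε : ℂ) ≠ 0 := by exact_mod_cast hε.ne'
  have hh' : (h : ℂ) ≠ 0 := by exact_mod_cast hh.ne'
  -- the frequency cancels `‖k‖²` in the Laplacian, and the transport equation cancels `k · ∇Φ`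
  have hcancel : φ * (Complex.I • (trigPoly S p - Vc) +
          (Complex.I * (h ^ 2 / ε / 2 : ℝ)) • (trigLaplacian S (a s) +
            ∑ i : Fin 2, trigDeriv S (a s) i ^ 2)) =
      (Complex.I * freq h k * (h / ε)) • φ + φ * trigPoly S a' - (Complex.I / ε) • χ := by
    ext x
    have htr := transport_identity (h := h) (ε := ε) k S p (t - s) x
    have hn : (‖toPlane k‖ : ℂ) ^ 2 = (k 0 : ℂ) ^ 2 + (k 1 : ℂ) ^ 2 := by
      exact_mod_cast congrArg ((↑) : ℝ → ℂ) (norm_toPlane_sq k)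
    have haf : (fun q => -Complex.I * (p q * oscInt (t - s) (inner ℝ (toPlane q) c))) = a s :=
      funext fun q => (ha s q).symm
    rw [← hc, haf, ← ha'] at htr
    simp only [ContinuousMap.mul_apply, ContinuousMap.add_apply, ContinuousMap.sub_apply,
      ContinuousMap.smul_apply, smul_eq_mul, htr, hχ, hA, Fin.sum_univ_two, ContinuousMap.pow_apply,
      ContinuousMap.one_apply, mul_one, freq]
    push_cast
    rw [hn]
    field_simp
    linear_combination (φ x * h ^ 2 * (4 * Real.pi * (trigDeriv S (a s) 0 x * k 0 +
      trigDeriv S (a s) 1 x * k 1)) - 4 * Real.pi ^ 2 * φ x * h ^ 2 * Complex.I *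
      ((k 0 : ℂ) ^ 2 + (k 1 : ℂ) ^ 2)) * Complex.I_sq
  rw [hcancel]
  simp only [← pairL_apply, map_add, map_sub, map_smul, add_apply, sub_apply, smul_apply,
    smul_eq_mul]
  simp only [pairL_apply, one_mul, Complex.real_smul]
  push_cast
  field_simp
  ring

/-- Comparison of the perturbed evolution with the approximate solution, in the time scale
`h / ε`. -/
lemma exists_norm_coeff_sub_le (S : Finset IntLattice) (p : IntLattice → ℂ) (t : ℝ) :
    ∃ C : ℝ, 0 ≤ C ∧ ∀ (V : Torus → ℝ) (Vc : C(Torus, ℂ)), (∀ x, Vc x = V x) →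
      ∀ (h ε : ℝ), 0 < h → 0 < ε → ∀ (ψ : L2Torus) (u : ℝ → L2Torus),
      IsSchrodingerSolution h (fun x => ε * V x) ψ u → ∀ k : IntLattice,
      ‖Complex.exp (Complex.I * freq h k * (t * (h / ε) : ℝ)) * coeff k (u (t * (h / ε))) -
        pair (wave k (-Complex.I • lineIntegral (velocity h ε k) t (trigPoly S p))) ψ‖ ≤
      Real.exp (|t| * ‖trigPoly S p‖) * (‖Vc - trigPoly S p‖ + h ^ 2 / ε * C) *
        (‖ψ‖ * Real.exp (|t| * ‖Vc‖)) * |t| := by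
  obtain ⟨C, hC0, hC⟩ := exists_bound_trigDeriv S p |t|
  refine ⟨C / 2, by positivity, fun V Vc hV h ε hh hε ψ u hu k => ?_⟩
  set a : ℝ → IntLattice → ℂ := fun r q =>
    -Complex.I * (p q * oscInt (t - r) (inner ℝ (toPlane q) (velocity h ε k))) with ha
  have hag : ∀ r, trigPoly S (a r) =
      -Complex.I • lineIntegral (velocity h ε k) (t - r) (trigPoly S p) := by
    intro r
    rw [lineIntegral_trigPoly]
    ext x
    simp only [ha, trigPoly_apply, ContinuousMap.smul_apply, smul_eq_mul, Finset.mul_sum]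
    exact Finset.sum_congr rfl fun q _ => by ring
  have hd := fun s => hasDerivAt_pair_wave hV hh hε hu k S p t s a (fun _ _ => rfl)
  have habs : ∀ s ∈ Set.uIcc 0 t, |s| ≤ |t| ∧ |t - s| ≤ |t| := by
    intro s hs
    constructor
    · simpa using Set.abs_sub_left_of_mem_uIcc hs
    · simpa using Set.abs_sub_right_of_mem_uIcc hs
  have hue : ∀ s ∈ Set.uIcc 0 t, ‖u (s * (h / ε))‖ ≤ ‖ψ‖ * Real.exp (|t| * ‖Vc‖) := by
    intro s hs
    have h1 := hu.norm_sq_le hh (Wc := (ε : ℂ) • Vc) (fun x => by simp [hV]) (s * (h / ε))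
    refine (sq_le_sq₀ (norm_nonneg _) (by positivity)).1 (h1.trans ?_)
    rw [mul_pow, ← Real.exp_nat_mul]
    refine mul_le_mul_of_nonneg_left (Real.exp_le_exp.2 ?_) (sq_nonneg _)
    rw [norm_smul, abs_mul, Complex.norm_real, Real.norm_eq_abs, abs_of_pos hε,
      abs_of_pos (div_pos hh hε)]
    calc _ = 2 * (|s| * ‖Vc‖) := by field_simp
      _ ≤ _ := by
        push_cast
        have := mul_le_mul_of_nonneg_right (habs s hs).1 (norm_nonneg Vc)
        linarith
  have hbound := (convex_uIcc 0 t).norm_image_sub_le_of_norm_hasDerivWithin_le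
    (C := Real.exp (|t| * ‖trigPoly S p‖) * (‖Vc - trigPoly S p‖ + h ^ 2 / ε * (C / 2)) *
        (‖ψ‖ * Real.exp (|t| * ‖Vc‖)))
    (fun s _ => (hd s).hasDerivWithinAt) (fun s hs => ?_) Set.left_mem_uIcc Set.right_mem_uIcc
  -- the phase vanishes at the final time, where only the plane wave is left
  · have h0 : trigPoly S (a t) = 0 := by 
      rw [hag, sub_self, lineIntegral, intervalIntegral.integral_same]
      exact smul_zero (A := C(Torus, ℂ)) (-Complex.I)
    have h1 : wave k (trigPoly S (a t)) = UnitAddTorus.mFourier (-k) := by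
      rw [h0]; simp [wave]
    rw [h1, hag 0, sub_zero] at hbound
    simpa [hu.initial, coeff] using hbound
  · have hexp : ‖Complex.exp (Complex.I * freq h k * (s * (h / ε) : ℝ))‖ = 1 := by
      rw [mul_assoc, mul_comm, ← Complex.ofReal_mul, Complex.norm_exp_ofReal_mul_I]
    rw [norm_mul, hexp, one_mul]
    refine (norm_pair_le _ _).trans ?_
    have hg : ‖trigPoly S (a s)‖ ≤ |t| * ‖trigPoly S p‖ := by
      rw [hag, norm_smul, norm_neg, Complex.norm_I, one_mul]
      refine (norm_lineIntegral_le _ _ _).trans ?_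
      exact mul_le_mul_of_nonneg_right (habs s hs).2 (norm_nonneg _)
    have hR : ‖Complex.I • (trigPoly S p - Vc) +
          (Complex.I * (h ^ 2 / ε / 2 : ℝ)) • (trigLaplacian S (a s) +
            ∑ i : Fin 2, trigDeriv S (a s) i ^ 2)‖ ≤
        ‖Vc - trigPoly S p‖ + h ^ 2 / ε * (C / 2) := by
      refine (norm_add_le _ _).trans (add_le_add ?_ ?_)
      · rw [norm_smul, Complex.norm_I, one_mul, norm_sub_rev]
      · rw [norm_smul, norm_mul, Complex.norm_I, one_mul, Complex.norm_real, Real.norm_eq_abs,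
          abs_of_pos (by positivity)]
        calc _ ≤ h ^ 2 / ε / 2 * C := by
              gcongr
              refine hC (a s) fun q => ?_
              rw [ha, norm_mul, norm_neg, Complex.norm_I, one_mul, norm_mul, mul_comm]
              gcongr
              exact (norm_oscInt_le _ _).trans (habs s hs).2
          _ = _ := by ring
    gcongr
    · exact (norm_mul_le _ _).trans (mul_le_mul ((norm_wave_le _ _).trans (Real.exp_le_exp.2 hg))
        hR (norm_nonneg _) (Real.exp_pos _).le)
    · exact hue s hs

/-! ### Limits of line integrals -/

lemma tendsto_oscInt_zero {a : ℝ} {z : ℕ → ℝ} (hz : Tendsto (fun j => |z j|) atTop atTop) :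
    Tendsto (fun j => oscInt a (z j)) atTop (𝓝 0) := by
  rw [tendsto_zero_iff_norm_tendsto_zero]
  refine squeeze_zero' (Eventually.of_forall fun _ => norm_nonneg _) ?_
    (tendsto_inv_atTop_zero.comp hz)
  filter_upwards [hz.eventually_gt_atTop 0] with j hj
  rw [Function.comp_apply, ← one_div, le_div_iff₀ hj, mul_comm]
  exact norm_oscInt_mul_le a (z j)

/-- Convergence of line integrals for all continuous functions follows from convergence of the
multipliers of the plane waves, by density of the trigonometric polynomials. -/
lemma tendsto_lineIntegral {c : ℕ → Plane} {t : ℝ} {T : C(Torus, ℂ) → C(Torus, ℂ)}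
    {τ : IntLattice → ℂ} (hsub : ∀ f g, T (f - g) = T f - T g)
    (hnorm : ∀ f, ‖T f‖ ≤ |t| * ‖f‖)
    (htrig : ∀ S p, T (trigPoly S p) = trigPoly S fun q => p q * τ q)
    (hτ : ∀ q, Tendsto (fun j => oscInt t (inner ℝ (toPlane q) (c j))) atTop (𝓝 (τ q)))
    (f : C(Torus, ℂ)) :
    Tendsto (fun j => lineIntegral (c j) t f) atTop (𝓝 (T f)) := by
  refine Metric.tendsto_atTop'.2 fun η hη => ?_
  obtain ⟨S, p, hP⟩ := exists_trigPoly_near f (δ := η / (3 * (|t| + 1))) (by positivity)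
  set P := trigPoly S p
  have hP' : |t| * ‖f - P‖ < η / 3 := by
    rw [lt_div_iff₀ (by positivity)] at hP
    have := norm_nonneg (f - P)
    nlinarith
  have hlim : Tendsto (fun j => lineIntegral (c j) t P) atTop (𝓝 (T P)) := by
    simp only [P, htrig, lineIntegral_trigPoly]
    exact tendsto_finsetSum _ fun q _ => ((hτ q).const_mul (p q)).smul_const _
  obtain ⟨N, hN⟩ := Metric.tendsto_atTop'.1 hlim (η / 3) (by positivity)
  refine ⟨N, fun j hj => ?_⟩
  have h1 := hN j hj
  rw [dist_eq_norm] at h1 ⊢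
  have h2 : lineIntegral (c j) t f - T f = lineIntegral (c j) t (f - P) +
      (lineIntegral (c j) t P - T P) - T (f - P) := by
    rw [hsub, lineIntegral_sub]; abel
  rw [h2]
  calc _ ≤ ‖lineIntegral (c j) t (f - P)‖ + ‖lineIntegral (c j) t P - T P‖ + ‖T (f - P)‖ :=
        (norm_sub_le _ _).trans (by gcongr; exact norm_add_le _ _)
    _ < η / 3 + η / 3 + η / 3 := by
        linarith [(norm_lineIntegral_le (c j) t (f - P)).trans_lt hP',
          (hnorm (f - P)).trans_lt hP']
    _ = η := by ring

/-! ### Semiclassical limits of Fourier coefficients and of the echo -/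

lemma norm_wave_sub_le (k : IntLattice) (f g : C(Torus, ℂ)) :
    ‖wave k f - wave k g‖ ≤ ‖NormedSpace.exp f - NormedSpace.exp g‖ := by
  rw [wave, wave, ← mul_sub]
  refine (norm_mul_le _ _).trans_eq ?_
  rw [UnitAddTorus.mFourier_norm, one_mul]

section Limits

variable {V : Torus → ℝ} {Vc : C(Torus, ℂ)} {h ε : ℕ → ℝ} {ψ : ℕ → L2Torus}
  {u uε : ℕ → ℝ → L2Torus} {k l : ℕ → IntLattice} {t : ℝ} {G : C(Torus, ℂ)}

/-- In the limit, the coefficient of `u^ε` at `k` is, up to a phase, the pairing of the initial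
datum with `e_{-k} exp (-i G)`, where `G` is the limit of the classical phases. -/
lemma tendsto_coeff_sub_pair (hV : ∀ x, Vc x = V x) (hh : ∀ j, 0 < h j) (hε : ∀ j, 0 < ε j)
    (hsmall : Tendsto (fun j => h j ^ 2 / ε j) atTop (𝓝 0))
    (huε : ∀ j, IsSchrodingerSolution (h j) (fun x => ε j * V x) (ψ j) (uε j))
    {M : ℝ} (hM : ∀ j, ‖ψ j‖ ≤ M)
    (hG : Tendsto (fun j => lineIntegral (velocity (h j) (ε j) (k j)) t Vc) atTop (𝓝 G)) :
    Tendsto (fun j =>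
      Complex.exp (Complex.I * freq (h j) (k j) * (t * (h j / ε j) : ℝ)) *
        coeff (k j) (uε j (t * (h j / ε j))) -
      pair (wave (k j) (-Complex.I • G)) (ψ j)) atTop (𝓝 0) := by
  refine Metric.tendsto_nhds.2 fun η hη => ?_
  have hM0 : 0 ≤ M := (norm_nonneg _).trans (hM 0)
  set B : ℝ := Real.exp (|t| * (‖Vc‖ + 1)) * (M * Real.exp (|t| * ‖Vc‖)) * |t| with hB
  have hB0 : 0 ≤ B := by positivity
  have hexpc : ContinuousAt (NormedSpace.exp : C(Torus, ℂ) → C(Torus, ℂ)) (-Complex.I • G) :=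
    NormedSpace.exp_continuous.continuousAt
  obtain ⟨ρ, hρ, hρe⟩ := Metric.continuousAt_iff.1 hexpc (η / (3 * (M + 1))) (by positivity)
  -- the bounds make `P` comparable to `Vc`, its phase close to `G`, and the error term small
  obtain ⟨S, p, hP⟩ := exists_trigPoly_near Vc
    (δ := min 1 (min (ρ / (2 * (|t| + 1))) (η / (3 * (B + 1))))) (by positivity)
  set P := trigPoly S p with hPdef
  obtain ⟨hP1, hP23⟩ := lt_min_iff.1 hP
  obtain ⟨hP2, hP3⟩ := lt_min_iff.1 hP23
  have hPn : ‖P‖ ≤ ‖Vc‖ + 1 := by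
    have : P = Vc - (Vc - P) := by abel
    rw [this]
    exact (norm_sub_le _ _).trans (by linarith)
  have hP2' : |t| * ‖Vc - P‖ < ρ / 2 := by
    rw [lt_div_iff₀ (by positivity)] at hP2
    have := norm_nonneg (Vc - P)
    nlinarith
  have hP3' : B * ‖Vc - P‖ < η / 3 := by
    rw [lt_div_iff₀ (by positivity)] at hP3
    have := norm_nonneg (Vc - P)
    nlinarith
  obtain ⟨C, hC0, hC⟩ := exists_norm_coeff_sub_le S p t
  have hsm : Tendsto (fun j => B * (h j ^ 2 / ε j * C)) atTop (𝓝 0) := by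
    simpa using (hsmall.mul_const C).const_mul B
  filter_upwards [hsm.eventually_lt_const (show (0 : ℝ) < η / 3 by positivity),
    Metric.tendsto_nhds.1 hG (ρ / 2) (by positivity)] with j hj1 hj2
  have e1 := hC V Vc hV (h j) (ε j) (hh j) (hε j) (ψ j) (uε j) (huε j) (k j)
  set X := Complex.exp (Complex.I * freq (h j) (k j) * (t * (h j / ε j) : ℝ)) *
        coeff (k j) (uε j (t * (h j / ε j)))
  set g : C(Torus, ℂ) := -Complex.I • lineIntegral (velocity (h j) (ε j) (k j)) t P with hg
  have e1' : ‖X - pair (wave (k j) g) (ψ j)‖ < 2 * (η / 3) := by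
    refine e1.trans_lt ?_
    have hq : 0 ≤ h j ^ 2 / ε j := div_nonneg (sq_nonneg _) (hε j).le
    calc _ ≤ Real.exp (|t| * (‖Vc‖ + 1)) * (‖Vc - P‖ + h j ^ 2 / ε j * C) *
          (M * Real.exp (|t| * ‖Vc‖)) * |t| := by
          gcongr
          exact hM j
      _ = B * ‖Vc - P‖ + B * (h j ^ 2 / ε j * C) := by rw [hB]; ring
      _ < _ := by linarith
  have e2 : ‖pair (wave (k j) g) (ψ j) - pair (wave (k j) (-Complex.I • G)) (ψ j)‖ < η / 3 := by
    have hdist : dist g (-Complex.I • G) < ρ := by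
      have h3 : g - -Complex.I • G = -Complex.I •
          (lineIntegral (velocity (h j) (ε j) (k j)) t P - G) :=
        (smul_sub (A := C(Torus, ℂ)) (-Complex.I) _ _).symm
      rw [dist_eq_norm, h3, norm_smul, norm_neg, Complex.norm_I, one_mul]
      have h4 : lineIntegral (velocity (h j) (ε j) (k j)) t P - G =
          (lineIntegral (velocity (h j) (ε j) (k j)) t Vc - G) -
            lineIntegral (velocity (h j) (ε j) (k j)) t (Vc - P) := by
        rw [lineIntegral_sub]; abel
      rw [h4]
      refine (norm_sub_le _ _).trans_lt ?_
      rw [dist_eq_norm] at hj2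
      linarith [norm_lineIntegral_le (velocity (h j) (ε j) (k j)) t (Vc - P)]
    have h4 := hρe hdist
    rw [dist_eq_norm, lt_div_iff₀ (by positivity)] at h4
    rw [← pairL_apply, ← pairL_apply, ← sub_apply, ← map_sub, pairL_apply]
    have h5 := norm_wave_sub_le (k j) g (-Complex.I • G)
    have h6 := norm_nonneg (NormedSpace.exp g - NormedSpace.exp (-Complex.I • G))
    have h7 : ‖pair (wave (k j) g - wave (k j) (-Complex.I • G)) (ψ j)‖ ≤
        ‖NormedSpace.exp g - NormedSpace.exp (-Complex.I • G)‖ * M :=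
      (norm_pair_le _ _).trans (mul_le_mul h5 (hM j) (norm_nonneg _) h6)
    nlinarith
  rw [dist_zero_right]
  calc _ = ‖(X - pair (wave (k j) g) (ψ j)) +
        (pair (wave (k j) g) (ψ j) - pair (wave (k j) (-Complex.I • G)) (ψ j))‖ := by
        congr 1; ring
    _ ≤ _ := norm_add_le _ _
    _ < η := by linarith

/-- Shifting the wave vector out of the pairing leaves a Fourier coefficient of the amplitude. -/
lemma pair_wave_planeWave (k l : IntLattice) (g : C(Torus, ℂ)) :
    pair (wave k g) (planeWave l) = coeff (k - l) (toL2 (NormedSpace.exp g)) := by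
  rw [planeWave_eq, pair_toL2, coeff, pair_toL2]
  congr 1
  funext x
  rw [wave, ContinuousMap.mul_apply, mul_right_comm, ← UnitAddTorus.mFourier_add, neg_sub,
    sub_eq_neg_add]

lemma norm_planeWave (k : IntLattice) : ‖planeWave k‖ = 1 := orthonormal_planeWave.1 k

lemma echo_eq_of_phase {uε u : ℝ → L2Torus} {ψ : L2Torus} {s ν : ℝ}
    (hu : u s = Complex.exp (-(Complex.I * ν * s)) • ψ) :
    echo uε u s = ‖inner ℂ ψ (uε s)‖ ^ 2 := by
  have h1 : -(Complex.I * ν * s) = ((-(ν * s) : ℝ) : ℂ) * Complex.I := by push_cast; ring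
  rw [echo, hu, inner_smul_right, norm_mul, h1, Complex.norm_exp_ofReal_mul_I, one_mul,
    norm_inner_symm]

/-- The limit of the echo of a plane wave, once the classical phases converge to `G`. -/
lemma tendsto_echo_planeWave (hV : ∀ x, Vc x = V x) (hh : ∀ j, 0 < h j) (hε : ∀ j, 0 < ε j)
    (hsmall : Tendsto (fun j => h j ^ 2 / ε j) atTop (𝓝 0))
    (hu : ∀ j, IsSchrodingerSolution (h j) (fun _ => 0) (ψ j) (u j))
    (huε : ∀ j, IsSchrodingerSolution (h j) (fun x => ε j * V x) (ψ j) (uε j))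
    (hψ : ∀ j, ψ j = planeWave (k j))
    (hG : Tendsto (fun j => lineIntegral (velocity (h j) (ε j) (k j)) t Vc) atTop (𝓝 G)) :
    Tendsto (fun j => echo (uε j) (u j) (t * (h j / ε j))) atTop
      (𝓝 (‖coeff 0 (toL2 (NormedSpace.exp (-Complex.I • G)))‖ ^ 2)) := by
  have hlim := tendsto_coeff_sub_pair hV hh hε hsmall huε (M := 1)
    (fun j => (hψ j ▸ norm_planeWave (k j)).le) hG
  simp only [hψ, pair_wave_planeWave, sub_self] at hlim
  rw [tendsto_sub_nhds_zero_iff] at hlim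
  refine (hlim.norm.pow 2).congr fun j => ?_
  have hph := (hu j).eq_phase_smul (hh j).ne' (ν := freq (h j) (k j)) (fun q hq => by
    rw [hψ, coeff_planeWave] at hq
    rw [of_not_not fun hne => hq (if_neg hne)]) (t * (h j / ε j))
  rw [echo_eq_of_phase hph, hψ, ← coeff_eq_inner, norm_mul, mul_assoc, mul_comm Complex.I,
    ← Complex.ofReal_mul, Complex.norm_exp_ofReal_mul_I, one_mul]

/-- The limit of the echo of a superposition of two plane waves of the same energy with diverging
difference of wave vectors: the interference terms are high Fourier coefficients of fixed
functions. -/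
lemma tendsto_echo_superposition {G' : C(Torus, ℂ)} (hV : ∀ x, Vc x = V x)
    (hh : ∀ j, 0 < h j) (hε : ∀ j, 0 < ε j)
    (hsmall : Tendsto (fun j => h j ^ 2 / ε j) atTop (𝓝 0))
    (hu : ∀ j, IsSchrodingerSolution (h j) (fun _ => 0) (ψ j) (u j))
    (huε : ∀ j, IsSchrodingerSolution (h j) (fun x => ε j * V x) (ψ j) (uε j))
    (hψ : ∀ j, ψ j = ((1 / Real.sqrt 2 : ℝ) : ℂ) • (planeWave (k j) + planeWave (l j)))
    (hkl : ∀ j, ‖toPlane (k j)‖ = ‖toPlane (l j)‖)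
    (hdiff : Tendsto (fun j => k j - l j) atTop cofinite)
    (hG : Tendsto (fun j => lineIntegral (velocity (h j) (ε j) (k j)) t Vc) atTop (𝓝 G))
    (hG' : Tendsto (fun j => lineIntegral (velocity (h j) (ε j) (l j)) t Vc) atTop (𝓝 G')) :
    Tendsto (fun j => echo (uε j) (u j) (t * (h j / ε j))) atTop
      (𝓝 (‖(1 / 2 : ℂ) * (coeff 0 (toL2 (NormedSpace.exp (-Complex.I • G))) +
        coeff 0 (toL2 (NormedSpace.exp (-Complex.I • G'))))‖ ^ 2)) := by
  set r : ℂ := ((1 / Real.sqrt 2 : ℝ) : ℂ) with hr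
  have hrr : r * r = 1 / 2 := by
    rw [hr, ← Complex.ofReal_mul, div_mul_div_comm, Real.mul_self_sqrt (by norm_num)]
    norm_num
  have hM : ∀ j, ‖ψ j‖ ≤ ‖r‖ * 2 := by
    intro j
    rw [hψ, norm_smul]
    gcongr
    refine (norm_add_le _ _).trans ?_
    rw [norm_planeWave, norm_planeWave]
    norm_num
  have hfreq : ∀ j, freq (h j) (k j) = freq (h j) (l j) := fun j => by rw [freq, freq, hkl]
  have hdiff' : Tendsto (fun j => l j - k j) atTop cofinite := by
    have := (neg_injective (G := IntLattice)).tendsto_cofinite.comp hdiff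
    simpa [Function.comp_def] using this
  have hpair : ∀ (a b c : IntLattice) (g : C(Torus, ℂ)),
      pair (wave a g) (r • (planeWave b + planeWave c)) = r * (coeff (a - b)
        (toL2 (NormedSpace.exp g)) + coeff (a - c) (toL2 (NormedSpace.exp g))) := by
    intro a b c g
    rw [← pairL_apply, map_smul, map_add, pairL_apply, pairL_apply, pair_wave_planeWave,
      pair_wave_planeWave, smul_eq_mul]
  have h1 := tendsto_coeff_sub_pair hV hh hε hsmall huε hM hG
  have h2 := tendsto_coeff_sub_pair hV hh hε hsmall huε hM hG'
  simp only [hψ, hpair, sub_self] at h1 h2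
  have h3 := ((((tendsto_coeff_cofinite (toL2 (NormedSpace.exp (-Complex.I • G)))).comp
    hdiff).const_add (coeff 0 (toL2 (NormedSpace.exp (-Complex.I • G))))).const_mul r)
  have h4 := ((((tendsto_coeff_cofinite (toL2 (NormedSpace.exp (-Complex.I • G')))).comp
    hdiff').add_const (coeff 0 (toL2 (NormedSpace.exp (-Complex.I • G'))))).const_mul r)
  have h5 := (((h1.add h3).add (h2.add h4)).const_mul r).norm.pow 2
  have hval : r * (0 + r * (coeff 0 (toL2 (NormedSpace.exp (-Complex.I • G))) + 0) +
      (0 + r * (0 + coeff 0 (toL2 (NormedSpace.exp (-Complex.I • G')))))) =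
      (1 / 2 : ℂ) * (coeff 0 (toL2 (NormedSpace.exp (-Complex.I • G))) +
        coeff 0 (toL2 (NormedSpace.exp (-Complex.I • G')))) := by
    rw [← hrr]; ring
  rw [hval] at h5
  refine h5.congr fun j => ?_
  have hph := (hu j).eq_phase_smul (hh j).ne' (ν := freq (h j) (k j)) (fun q hq => by
    by_cases hqk : q = k j
    · rw [hqk]
    by_cases hql : q = l j
    · rw [hql, hfreq]
    refine absurd ?_ hq
    rw [hψ, coeff_eq_inner, inner_smul_right, inner_add_right, ← coeff_eq_inner,
      ← coeff_eq_inner, coeff_planeWave, coeff_planeWave, if_neg hqk, if_neg hql]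
    simp) (t * (h j / ε j))
  have hcr : (starRingEnd ℂ) r = r := Complex.conj_ofReal _
  rw [echo_eq_of_phase hph, hψ, inner_smul_left, inner_add_left, ← coeff_eq_inner,
    ← coeff_eq_inner, hcr, ← hfreq]
  have hn : ‖Complex.exp (Complex.I * freq (h j) (k j) * (t * (h j / ε j) : ℝ))‖ = 1 := by
    rw [mul_assoc, mul_comm Complex.I, ← Complex.ofReal_mul, Complex.norm_exp_ofReal_mul_I]
  have hz : ∀ z : ℂ, ‖z‖ =
      ‖Complex.exp (Complex.I * freq (h j) (k j) * (t * (h j / ε j) : ℝ)) * z‖ := fun z => by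
    rw [norm_mul, hn, one_mul]
  rw [hz (r * (coeff (k j) _ + coeff (l j) _))]
  congr 2
  simp only [Function.comp_apply]
  ring

end Limits

/-! ### Primitive lattices and their averages -/

/-- Collinearity with `v ≠ 0` is the vanishing of the determinant. -/
lemma mem_span_toPlane_singleton {k v : IntLattice} (hv : v ≠ 0) :
    toPlane k ∈ Submodule.span ℝ {toPlane v} ↔ k 0 * v 1 = k 1 * v 0 := by
  rw [Submodule.mem_span_singleton]
  constructor
  · rintro ⟨r, hr⟩
    have h0 : r * v 0 = k 0 := by simpa [toPlane] using congrArg (fun y : Plane => y 0) hr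
    have h1 : r * v 1 = k 1 := by simpa [toPlane] using congrArg (fun y : Plane => y 1) hr
    have : (k 0 * v 1 : ℝ) = k 1 * v 0 := by rw [← h0, ← h1]; ring
    exact_mod_cast this
  · intro hk
    have hk' : (k 0 * v 1 : ℝ) = k 1 * v 0 := by exact_mod_cast hk
    by_cases h0 : v 0 = 0
    · have h1 : v 1 ≠ 0 := fun h1 => hv (by ext i; fin_cases i <;> simp [h0, h1])
      have h1' : (v 1 : ℝ) ≠ 0 := by exact_mod_cast h1
      have h0' : (v 0 : ℝ) = 0 := by exact_mod_cast h0
      have hk0 : (k 0 : ℝ) = 0 := by simpa [h0', h1'] using hk'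
      refine ⟨k 1 / v 1, ?_⟩
      ext i
      fin_cases i <;> simp [toPlane, h0', hk0, h1']
    · have h0' : (v 0 : ℝ) ≠ 0 := by exact_mod_cast h0
      refine ⟨k 0 / v 0, ?_⟩
      ext i
      fin_cases i
      · simp [toPlane, h0']
      · simp only [toPlane, Fin.mk_one, PiLp.smul_apply, smul_eq_mul]
        rw [div_mul_eq_mul_div, hk', mul_div_assoc, div_self h0', mul_one]

lemma toPlane_zsmul (n : ℤ) (v : IntLattice) : toPlane (n • v) = (n : ℝ) • toPlane v := by
  ext i; simp [toPlane]

lemma toPlane_neg (v : IntLattice) : toPlane (-v) = -toPlane v := by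
  ext i; simp [toPlane]

lemma span_toPlane_zmultiples (v : IntLattice) :
    Submodule.span ℝ (toPlane '' (AddSubgroup.zmultiples v : Set IntLattice)) =
      Submodule.span ℝ {toPlane v} := by
  refine le_antisymm (Submodule.span_le.2 ?_) (Submodule.span_mono ?_)
  · rintro _ ⟨_, ⟨n, rfl⟩, rfl⟩
    rw [SetLike.mem_coe, Submodule.mem_span_singleton]
    exact ⟨n, (toPlane_zsmul n v).symm⟩
  · rw [Set.singleton_subset_iff]
    exact ⟨v, AddSubgroup.mem_zmultiples v, rfl⟩

lemma toPlane_ne_zero {v : IntLattice} (hv : v ≠ 0) : toPlane v ≠ 0 := by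
  intro h
  refine hv (funext fun i => ?_)
  have := congrArg (fun y : Plane => y i) h
  simpa [toPlane] using this

section Primitive

variable {Λ : AddSubgroup IntLattice} {v : IntLattice}

lemma IsPrimitiveRankOne.gen_ne_zero (hΛ : IsPrimitiveRankOne Λ) (hv : IsGenerator v Λ) :
    v ≠ 0 := by
  rintro rfl
  have h := hΛ.1
  have h0 : toPlane 0 = 0 := by ext i; simp [toPlane]
  rw [← show AddSubgroup.zmultiples 0 = Λ from hv, span_toPlane_zmultiples, h0,
    Submodule.span_zero_singleton, finrank_bot] at h
  exact zero_ne_one h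

lemma IsPrimitiveRankOne.mem_of_cross_eq (hΛ : IsPrimitiveRankOne Λ) (hv : IsGenerator v Λ)
    {k : IntLattice} (hk : k 0 * v 1 = k 1 * v 0) : ∃ n : ℤ, n • v = k := by
  have h : k ∈ Λ := by
    refine hΛ.2 k ?_
    rw [← show AddSubgroup.zmultiples v = Λ from hv, span_toPlane_zmultiples,
      mem_span_toPlane_singleton (hΛ.gen_ne_zero hv)]
    exact hk
  rw [← show AddSubgroup.zmultiples v = Λ from hv] at h
  exact AddSubgroup.mem_zmultiples_iff.1 h

lemma rot_rot (v : IntLattice) : rot (rot v) = -v := by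
  ext i; fin_cases i <;> simp [rot]

lemma norm_toPlane_rot (v : IntLattice) : ‖toPlane (rot v)‖ = ‖toPlane v‖ := by
  rw [← sq_eq_sq₀ (norm_nonneg _) (norm_nonneg _), norm_toPlane_sq, norm_toPlane_sq]
  simp [rot]
  ring

lemma orthLattice_eq_zmultiples (hΛ : IsPrimitiveRankOne Λ) (hv : IsGenerator v Λ) :
    AddSubgroup.zmultiples (rot v) = orthLattice Λ := by
  ext k
  constructor
  · rintro ⟨n, rfl⟩ l hl
    rw [← show AddSubgroup.zmultiples v = Λ from hv] at hl
    obtain ⟨m, rfl⟩ := AddSubgroup.mem_zmultiples_iff.1 hl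
    simp [rot, dotProduct, Fin.sum_univ_two]
    ring
  · intro hk
    have h1 := hk v (hv ▸ AddSubgroup.mem_zmultiples v)
    simp only [dotProduct, Fin.sum_univ_two] at h1
    obtain ⟨n, hn⟩ := hΛ.mem_of_cross_eq hv (k := ![k 1, -k 0]) (by simp; linarith)
    refine AddSubgroup.mem_zmultiples_iff.2 ⟨n, ?_⟩
    have e0 := congrFun hn 0
    have e1 := congrFun hn 1
    simp at e0 e1
    ext i
    fin_cases i
    · simp [rot]; linarith
    · simp [rot]; linarith

/-- The chosen generator of the orthogonal lattice is known only up to sign. -/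
lemma gen_orthLattice (hΛ : IsPrimitiveRankOne Λ) (hv : IsGenerator v Λ) :
    gen (orthLattice Λ) = rot v ∨ gen (orthLattice Λ) = -rot v := by
  have hr := orthLattice_eq_zmultiples hΛ hv
  have hg : AddSubgroup.zmultiples (gen (orthLattice Λ)) = orthLattice Λ :=
    Classical.epsilon_spec (p := fun w => IsGenerator w (orthLattice Λ)) ⟨rot v, hr⟩
  set g := gen (orthLattice Λ)
  obtain ⟨a, ha⟩ := AddSubgroup.mem_zmultiples_iff.1
    (show g ∈ AddSubgroup.zmultiples (rot v) by rw [hr, ← hg]; exact AddSubgroup.mem_zmultiples g)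
  obtain ⟨b, hb⟩ := AddSubgroup.mem_zmultiples_iff.1
    (show rot v ∈ AddSubgroup.zmultiples g by
      rw [hg, ← hr]; exact AddSubgroup.mem_zmultiples (rot v))
  have hr0 : rot v ≠ 0 := by
    intro h0
    have := rot_rot v
    rw [h0] at this
    have hz : v = 0 := by
      rw [← neg_eq_zero, ← this]; ext i; fin_cases i <;> simp [rot]
    exact hΛ.gen_ne_zero hv hz
  have hba : (b * a) • rot v = (1 : ℤ) • rot v := by rw [mul_smul, ha, hb, one_smul]
  have hab : b * a = 1 := smul_left_injective ℤ hr0 hba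
  rcases Int.isUnit_iff.1 (IsUnit.of_mul_eq_one_right _ hab) with h1 | h1
  · left; rw [← ha, h1, one_smul]
  · right; rw [← ha, h1, neg_smul, one_smul]

lemma proj_toPlane (v : IntLattice) : proj (toPlane v) = 0 := by
  funext i
  simp only [proj, toPlane, Pi.zero_apply]
  rw [AddCircle.coe_eq_zero_iff]
  exact ⟨v i, by simp⟩

/-- Reversing the orientation of a closed geodesic does not change the average along it. -/
lemma lineIntegral_neg_toPlane (v : IntLattice) (f : C(Torus, ℂ)) :
    lineIntegral (-toPlane v) 1 f = lineIntegral (toPlane v) 1 f := by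
  ext x
  rw [lineIntegral_apply, lineIntegral_apply]
  have h := intervalIntegral.integral_comp_sub_left (a := 0) (b := 1)
    (fun r : ℝ => f (x + proj (r • toPlane v))) 1
  simp only [sub_self, sub_zero] at h
  rw [← h]
  refine intervalIntegral.integral_congr fun r _ => ?_
  rw [sub_smul, one_smul, sub_eq_add_neg, proj_add, proj_toPlane, zero_add, smul_neg]

lemma ofReal_latticeAverage (hΛ : IsPrimitiveRankOne Λ) (hv : IsGenerator v Λ) {V : Torus → ℝ}
    {Vc : C(Torus, ℂ)} (hV : ∀ x, Vc x = V x) (x : Torus) :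
    (latticeAverage (orthLattice Λ) V x : ℂ) = lineIntegral (toPlane v) 1 Vc x := by
  have key : ∀ g : IntLattice, ‖toPlane g‖ ≠ 0 →
      ((‖toPlane g‖⁻¹ * ∫ s in (0 : ℝ)..‖toPlane g‖,
        V (x + proj ((s / ‖toPlane g‖) • toPlane (rot g))) : ℝ) : ℂ) =
      lineIntegral (toPlane (rot g)) 1 Vc x := by
    intro g hg
    rw [intervalIntegral.integral_comp_div (fun r => V (x + proj (r • toPlane (rot g)))) hg,
      smul_eq_mul, inv_mul_cancel_left₀ hg, zero_div, div_self hg, lineIntegral_apply,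
      ← intervalIntegral.integral_ofReal]
    simp only [hV]
  have hn : ‖toPlane (rot v)‖ ≠ 0 := by
    rw [norm_toPlane_rot]
    exact norm_ne_zero_iff.2 (toPlane_ne_zero (hΛ.gen_ne_zero hv))
  have hneg : rot (-rot v) = v := by
    ext i; fin_cases i <;> simp [rot]
  rw [latticeAverage]
  rcases gen_orthLattice hΛ hv with h | h <;> rw [h]
  · rw [key _ hn, rot_rot, toPlane_neg, lineIntegral_neg_toPlane]
  · rw [key _ (by rwa [toPlane_neg, norm_neg]), hneg]

lemma coeff_zero_toL2 (f : C(Torus, ℂ)) : coeff 0 (toL2 f) = ∫ x, f x ∂torusMeasure := by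
  rw [coeff, pair_toL2]
  simp [UnitAddTorus.mFourier_zero]

/-- The limiting phase `∫₀ᵗ I(V)(x + s ω v^⊥) ds`: the average of `V` along the closed geodesics
of direction `v`, transported orthogonally to `v`. -/
def resonantPhase (v : IntLattice) (ω t : ℝ) (f : C(Torus, ℂ)) : C(Torus, ℂ) :=
  lineIntegral (ω • toPlane (rot v)) t (lineIntegral (toPlane v) 1 f)

lemma coeff_zero_exp_resonantPhase (hΛ : IsPrimitiveRankOne Λ) (hv : IsGenerator v Λ)
    {V : Torus → ℝ} {Vc : C(Torus, ℂ)} (hV : ∀ x, Vc x = V x) (ω t : ℝ) :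
    coeff 0 (toL2 (NormedSpace.exp (-Complex.I • resonantPhase v ω t Vc))) =
      (starRingEnd ℂ) (transportIntegral V Λ v ω t) := by
  rw [coeff_zero_toL2, transportIntegral, ← integral_conj]
  refine integral_congr_ae (Eventually.of_forall fun x => ?_)
  simp only [exp_apply, ContinuousMap.smul_apply, smul_eq_mul, ← Complex.exp_conj, map_mul,
    Complex.conj_I, Complex.conj_ofReal, resonantPhase]
  rw [lineIntegral_apply, ← intervalIntegral.integral_ofReal]
  simp only [ofReal_latticeAverage hΛ hv hV, mul_smul]

end Primitive

/-! ### The classical limits along the sequence of wave vectors -/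

/-- The limiting phase when no frequency of the potential resonates with the motion. -/
def meanPhase (t : ℝ) (f : C(Torus, ℂ)) : C(Torus, ℂ) :=
  ContinuousMap.const _ (t * coeff 0 (toL2 f))

lemma norm_coeff_zero_toL2_le (f : C(Torus, ℂ)) : ‖coeff 0 (toL2 f)‖ ≤ ‖f‖ := by
  refine (norm_pair_le _ _).trans ?_
  rw [UnitAddTorus.mFourier_norm, one_mul]
  exact norm_toL2_le f

lemma norm_meanPhase_le (t : ℝ) (f : C(Torus, ℂ)) : ‖meanPhase t f‖ ≤ |t| * ‖f‖ := by
  refine (ContinuousMap.norm_le _ (by positivity)).2 fun x => ?_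
  rw [meanPhase, ContinuousMap.const_apply, norm_mul, Complex.norm_real, Real.norm_eq_abs]
  gcongr
  exact norm_coeff_zero_toL2_le f

lemma meanPhase_sub (t : ℝ) (f g : C(Torus, ℂ)) :
    meanPhase t (f - g) = meanPhase t f - meanPhase t g := by
  ext x
  simp only [meanPhase, coeff_eq_inner, map_sub, inner_sub_right, ContinuousMap.const_apply,
    ContinuousMap.sub_apply]
  ring

lemma meanPhase_trigPoly (t : ℝ) (S : Finset IntLattice) (p : IntLattice → ℂ) :
    meanPhase t (trigPoly S p) = trigPoly S fun q => p q * if q = 0 then (t : ℂ) else 0 := by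
  ext x
  simp only [meanPhase, trigPoly, map_sum, map_smul, ContinuousMap.const_apply, coeff_eq_inner,
    inner_sum, inner_smul_right, ← planeWave_eq, orthonormal_iff_ite.1 orthonormal_planeWave,
    ContinuousMap.sum_apply, ContinuousMap.smul_apply, smul_eq_mul, Finset.mul_sum]
  refine Finset.sum_congr rfl fun q _ => ?_
  by_cases hq : q = 0
  · subst hq; simp [UnitAddTorus.mFourier_zero, mul_comm]
  · simp [hq, Ne.symm hq]

lemma norm_coeff_exp_meanPhase {V : Torus → ℝ} {Vc : C(Torus, ℂ)} (hV : ∀ x, Vc x = V x)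
    (t : ℝ) : ‖coeff 0 (toL2 (NormedSpace.exp (-Complex.I • meanPhase t Vc)))‖ = 1 := by
  rw [coeff_zero_toL2]
  simp only [exp_apply, ContinuousMap.smul_apply, meanPhase, ContinuousMap.const_apply,
    coeff_zero_toL2, hV, integral_const, probReal_univ, one_smul, smul_eq_mul]
  have h : -Complex.I * (t * ((∫ x, V x ∂torusMeasure : ℝ) : ℂ)) =
      ((-(t * ∫ x, V x ∂torusMeasure) : ℝ) : ℂ) * Complex.I := by push_cast; ring
  rw [integral_complex_ofReal, h, Complex.norm_exp_ofReal_mul_I]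

lemma resonantPhase_sub (v : IntLattice) (ω t : ℝ) (f g : C(Torus, ℂ)) :
    resonantPhase v ω t (f - g) = resonantPhase v ω t f - resonantPhase v ω t g := by
  rw [resonantPhase, lineIntegral_sub, lineIntegral_sub]; rfl

lemma norm_resonantPhase_le (v : IntLattice) (ω t : ℝ) (f : C(Torus, ℂ)) :
    ‖resonantPhase v ω t f‖ ≤ |t| * ‖f‖ := by
  refine (norm_lineIntegral_le _ _ _).trans ?_
  gcongr
  simpa using norm_lineIntegral_le (toPlane v) 1 f

lemma resonantPhase_trigPoly (v : IntLattice) (ω t : ℝ) (S : Finset IntLattice)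
    (p : IntLattice → ℂ) :
    resonantPhase v ω t (trigPoly S p) = trigPoly S fun q =>
      p q * (oscInt 1 (inner ℝ (toPlane q) (toPlane v)) *
        oscInt t (inner ℝ (toPlane q) (ω • toPlane (rot v)))) := by
  rw [resonantPhase, lineIntegral_trigPoly, lineIntegral_trigPoly]
  congr 1
  funext q
  ring

lemma inner_toPlane_toPlane (q v : IntLattice) :
    inner ℝ (toPlane q) (toPlane v) = ((q 0 * v 0 + q 1 * v 1 : ℤ) : ℝ) := by
  rw [inner_toPlane]; simp [toPlane]

/-- Averaging over a full period kills the nonzero integral frequencies. -/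
lemma oscInt_one_intCast {n : ℤ} (hn : n ≠ 0) : oscInt 1 n = 0 := by
  have h := exp_eq_oscInt 1 n
  have h1 : Complex.exp (2 * Real.pi * Complex.I * ((1 : ℝ) * (n : ℝ))) = 1 := by
    rw [Complex.exp_eq_one_iff]
    exact ⟨n, by push_cast; ring⟩
  rw [h1] at h
  have h2 : 2 * Real.pi * Complex.I * (n : ℝ) * oscInt 1 n = 0 := by linear_combination -h
  simpa [hn, Real.pi_ne_zero] using h2

section Sequences

variable {h ε : ℕ → ℝ} {k : ℕ → IntLattice}

lemma inner_velocity_eq (a b : ℝ) (q k : IntLattice) :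
    inner ℝ (toPlane q) (velocity a b k) =
      2 * Real.pi * (a / b) * (a * inner ℝ (toPlane q) (toPlane k)) := by
  rw [velocity, inner_smul_right]; ring

/-- A frequency along which the limiting direction of motion has a nonzero component oscillates
infinitely fast in the time scale `h / ε`. -/
lemma tendsto_abs_inner_velocity (hh : ∀ j, 0 < h j) (hε : ∀ j, 0 < ε j)
    (hlarge : Tendsto (fun j => ε j / h j) atTop (𝓝 0)) {q : IntLattice} {L : ℝ} (hL : 0 < L)
    (hq : Tendsto (fun j => |h j * inner ℝ (toPlane q) (toPlane (k j))|) atTop (𝓝 L)) :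
    Tendsto (fun j => |inner ℝ (toPlane q) (velocity (h j) (ε j) (k j))|) atTop atTop := by
  have h1 : Tendsto (fun j => h j / ε j) atTop atTop := by
    have h2 : Tendsto (fun j => ε j / h j) atTop (𝓝[>] 0) :=
      tendsto_nhdsWithin_iff.2 ⟨hlarge, Eventually.of_forall fun j => div_pos (hε j) (hh j)⟩
    refine (tendsto_inv_nhdsGT_zero.comp h2).congr fun j => ?_
    simp
  have h3 := (h1.const_mul_atTop (show 0 < 2 * Real.pi by positivity)).atTop_mul_pos hL hq
  refine h3.congr fun j => ?_
  rw [inner_velocity_eq, abs_mul (2 * Real.pi * (h j / ε j)),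
    abs_of_pos (mul_pos (by positivity) (div_pos (hh j) (hε j)))]

/-- If `h k` is asymptotic to the direction of `v`, its component along `v` tends in absolute
value to `1 / ‖v‖`. -/
lemma tendsto_abs_component (hk : ∀ j, ‖toPlane (k j)‖ = (h j)⁻¹) (hh : ∀ j, 0 < h j)
    {v : IntLattice} (hv : v ≠ 0) {n m : ℕ → ℝ}
    (hnm : ∀ j, toPlane (k j) = n j • toPlane v + m j • toPlane (rot v))
    (hm : Tendsto (fun j => h j * m j) atTop (𝓝 0)) :
    Tendsto (fun j => |h j * n j|) atTop (𝓝 ‖toPlane v‖⁻¹) := by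
  have hvn : 0 < ‖toPlane v‖ := norm_pos_iff.2 (toPlane_ne_zero hv)
  have hid : ∀ j, (h j * n j) ^ 2 = (‖toPlane v‖⁻¹) ^ 2 - (h j * m j) ^ 2 := by
    intro j
    have e0 : (k j 0 : ℝ) = n j * v 0 - m j * v 1 := by
      have := congrArg (fun y : Plane => y 0) (hnm j)
      simpa [toPlane, rot, sub_eq_add_neg] using this
    have e1 : (k j 1 : ℝ) = n j * v 1 + m j * v 0 := by
      have := congrArg (fun y : Plane => y 1) (hnm j)
      simpa [toPlane, rot] using this
    have e2 := norm_toPlane_sq (k j)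
    have e3 := norm_toPlane_sq v
    have hhj := (hh j).ne'
    rw [hk, e0, e1] at e2
    have e4 : h j ^ 2 * (n j ^ 2 + m j ^ 2) * ‖toPlane v‖ ^ 2 = 1 := by
      rw [e3]
      have : h j ^ 2 * (h j)⁻¹ ^ 2 = 1 := by field_simp
      rw [e2] at this
      linear_combination this
    field_simp
    linear_combination e4
  have h1 : Tendsto (fun j => (h j * n j) ^ 2) atTop (𝓝 ((‖toPlane v‖⁻¹) ^ 2)) := by
    simp only [hid]
    have h3 := (hm.pow 2).const_sub ((‖toPlane v‖⁻¹) ^ 2)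
    rwa [zero_pow two_ne_zero, sub_zero] at h3
  have h2 := h1.sqrt
  simpa only [Real.sqrt_sq_eq_abs, abs_of_pos (inv_pos.2 hvn)] using h2

lemma inner_toPlane_of_eq {k v : IntLattice} {n m : ℝ}
    (hk : toPlane k = n • toPlane v + m • toPlane (rot v)) (q : IntLattice) :
    inner ℝ (toPlane q) (toPlane k) =
      n * inner ℝ (toPlane q) (toPlane v) + m * inner ℝ (toPlane q) (toPlane (rot v)) := by
  rw [hk, inner_add_right, inner_smul_right, inner_smul_right]

lemma tendsto_abs_inner_velocity_of_component (hh : ∀ j, 0 < h j) (hε : ∀ j, 0 < ε j)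
    (hlarge : Tendsto (fun j => ε j / h j) atTop (𝓝 0))
    (hk : ∀ j, ‖toPlane (k j)‖ = (h j)⁻¹)
    {v : IntLattice} (hv : v ≠ 0) {n m : ℕ → ℝ}
    (hnm : ∀ j, toPlane (k j) = n j • toPlane v + m j • toPlane (rot v))
    (hm : Tendsto (fun j => h j * m j) atTop (𝓝 0)) {q : IntLattice}
    (hq : inner ℝ (toPlane q) (toPlane v) ≠ (0 : ℝ)) :
    Tendsto (fun j => |inner ℝ (toPlane q) (velocity (h j) (ε j) (k j))|) atTop atTop := by
  have hvn : 0 < ‖toPlane v‖ := norm_pos_iff.2 (toPlane_ne_zero hv)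
  refine tendsto_abs_inner_velocity hh hε hlarge
    (L := ‖toPlane v‖⁻¹ * |inner ℝ (toPlane q) (toPlane v)|)
    (mul_pos (inv_pos.2 hvn) (abs_pos.2 hq)) ?_
  have h1 := (tendsto_abs_component hk hh hv hnm hm).mul_const |inner ℝ (toPlane q) (toPlane v)|
  have h2 := (hm.mul_const (inner ℝ (toPlane q) (toPlane (rot v)))).abs
  rw [zero_mul, abs_zero] at h2
  refine tendsto_of_tendsto_of_dist h1 (squeeze_zero (fun _ => dist_nonneg) (fun j => ?_) h2)
  rw [Real.dist_eq, ← abs_mul]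
  refine (abs_abs_sub_abs_le_abs_sub _ _).trans_eq ?_
  rw [inner_toPlane_of_eq (hnm j) q, ← abs_neg]
  congr 1
  ring

lemma inner_velocity_of_inner_eq_zero {a b : ℝ} {k v q : IntLattice} {n m : ℝ}
    (hk : toPlane k = n • toPlane v + m • toPlane (rot v))
    (hq : inner ℝ (toPlane q) (toPlane v) = (0 : ℝ)) :
    inner ℝ (toPlane q) (velocity a b k) =
      2 * Real.pi * m * a ^ 2 / b * inner ℝ (toPlane q) (toPlane (rot v)) := by
  rw [inner_velocity_eq, inner_toPlane_of_eq hk, hq]; ring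

lemma eq_zero_of_inner_eq_zero {q v : IntLattice} (hv : v ≠ 0)
    (h1 : inner ℝ (toPlane q) (toPlane v) = (0 : ℝ))
    (h2 : inner ℝ (toPlane q) (toPlane (rot v)) = (0 : ℝ)) : q = 0 := by
  rw [inner_toPlane_toPlane] at h1 h2
  have e1 : q 0 * v 0 + q 1 * v 1 = 0 := by exact_mod_cast h1
  have e2 : -(q 0 * v 1) + q 1 * v 0 = 0 := by simpa [rot] using (by exact_mod_cast h2 :
    q 0 * rot v 0 + q 1 * rot v 1 = 0)
  have hs : v 0 ^ 2 + v 1 ^ 2 ≠ 0 := by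
    intro hs
    have e : v 0 = 0 ∧ v 1 = 0 := by constructor <;> nlinarith
    exact hv (funext fun i => by fin_cases i <;> simp [e.1, e.2])
  ext i
  fin_cases i
  · have : q 0 * (v 0 ^ 2 + v 1 ^ 2) = 0 := by linear_combination v 0 * e1 - v 1 * e2
    simpa [hs] using this
  · have : q 1 * (v 0 ^ 2 + v 1 ^ 2) = 0 := by linear_combination v 1 * e1 + v 0 * e2
    simpa [hs] using this

/-- If every nonzero frequency oscillates infinitely fast, only the mean of the potential is
felt. -/
lemma tendsto_lineIntegral_meanPhase {t : ℝ}
    (hq : ∀ q : IntLattice, q ≠ 0 →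
      Tendsto (fun j => |inner ℝ (toPlane q) (velocity (h j) (ε j) (k j))|) atTop atTop)
    (f : C(Torus, ℂ)) :
    Tendsto (fun j => lineIntegral (velocity (h j) (ε j) (k j)) t f) atTop
      (𝓝 (meanPhase t f)) := by
  refine tendsto_lineIntegral (meanPhase_sub t) (norm_meanPhase_le t) (meanPhase_trigPoly t)
    (fun q => ?_) f
  by_cases h0 : q = 0
  · subst h0
    have : ∀ y : Plane, inner ℝ (toPlane 0) y = 0 := fun y => by simp [inner_toPlane]
    simp [this, oscInt_zero]
  · rw [if_neg h0]
    exact tendsto_oscInt_zero (hq q h0)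

/-- At the critical rate the frequencies orthogonal to `v` survive, transported with velocity
`ω v^⊥`, and all others oscillate infinitely fast. -/
lemma tendsto_lineIntegral_resonantPhase (hh : ∀ j, 0 < h j) (hε : ∀ j, 0 < ε j)
    (hlarge : Tendsto (fun j => ε j / h j) atTop (𝓝 0))
    (hk : ∀ j, ‖toPlane (k j)‖ = (h j)⁻¹)
    {v : IntLattice} (hv : v ≠ 0) {n m : ℕ → ℝ}
    (hnm : ∀ j, toPlane (k j) = n j • toPlane v + m j • toPlane (rot v))
    (hm : Tendsto (fun j => h j * m j) atTop (𝓝 0)) {ω : ℝ}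
    (hω : Tendsto (fun j => 2 * Real.pi * m j * h j ^ 2 / ε j) atTop (𝓝 ω)) (t : ℝ)
    (f : C(Torus, ℂ)) :
    Tendsto (fun j => lineIntegral (velocity (h j) (ε j) (k j)) t f) atTop
      (𝓝 (resonantPhase v ω t f)) := by
  refine tendsto_lineIntegral (resonantPhase_sub v ω t) (norm_resonantPhase_le v ω t)
    (resonantPhase_trigPoly v ω t) (fun q => ?_) f
  by_cases hq : inner ℝ (toPlane q) (toPlane v) = (0 : ℝ)
  · simp only [inner_velocity_of_inner_eq_zero (hnm _) hq]
    rw [hq, oscInt_zero, Complex.ofReal_one, one_mul, inner_smul_right]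
    exact ((continuous_oscInt t).tendsto _).comp (hω.mul_const _)
  · have h1 : oscInt 1 (inner ℝ (toPlane q) (toPlane v)) = 0 := by
      rw [inner_toPlane_toPlane] at hq ⊢
      exact oscInt_one_intCast (by exact_mod_cast hq)
    rw [h1, zero_mul]
    exact tendsto_oscInt_zero
      (tendsto_abs_inner_velocity_of_component hh hε hlarge hk hv hnm hm hq)

/-- Wave vectors whose directions approach two different rational directions move apart. -/
lemma tendsto_sub_cofinite {l : ℕ → IntLattice} (hh : ∀ j, 0 < h j)
    (hh0 : Tendsto h atTop (𝓝 0))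
    (hk : ∀ j, ‖toPlane (k j)‖ = (h j)⁻¹) {v₁ v₂ : IntLattice} (hv₁ : v₁ ≠ 0)
    (hcross : v₁ 0 * v₂ 1 - v₁ 1 * v₂ 0 ≠ 0) {n₁ m₁ n₂ m₂ : ℕ → ℝ}
    (hkv : ∀ j, toPlane (k j) = n₁ j • toPlane v₁ + m₁ j • toPlane (rot v₁))
    (hlv : ∀ j, toPlane (l j) = n₂ j • toPlane v₂ + m₂ j • toPlane (rot v₂))
    (hm₁ : Tendsto (fun j => h j * m₁ j) atTop (𝓝 0))
    (hm₂ : Tendsto (fun j => h j * m₂ j) atTop (𝓝 0)) :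
    Tendsto (fun j => k j - l j) atTop cofinite := by
  refine le_cofinite_iff_eventually_ne.2 fun q => ?_
  rw [eventually_map]
  -- if `k - l = q`, pairing with `v₂^⊥` bounds the component of `h k` along `v₁` by a null sequence
  have hD : inner ℝ (toPlane (rot v₂)) (toPlane v₁) ≠ (0 : ℝ) := by
    rw [inner_toPlane_toPlane]
    intro h0
    refine hcross ?_
    have h1 : rot v₂ 0 * v₁ 0 + rot v₂ 1 * v₁ 1 = 0 := by exact_mod_cast h0
    simp only [rot, Matrix.cons_val_zero, Matrix.cons_val_one] at h1
    linarith
  have h0 : inner ℝ (toPlane (rot v₂)) (toPlane v₂) = (0 : ℝ) := by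
    rw [inner_toPlane_toPlane]
    simp only [rot, Matrix.cons_val_zero, Matrix.cons_val_one]
    push_cast
    ring
  set D : ℝ := inner ℝ (toPlane (rot v₂)) (toPlane v₁) with hDdef
  set E : ℝ := inner ℝ (toPlane (rot v₂)) (toPlane (rot v₁)) with hE
  set F : ℝ := inner ℝ (toPlane (rot v₂)) (toPlane (rot v₂)) with hF
  set Q : ℝ := inner ℝ (toPlane (rot v₂)) (toPlane q) with hQ
  have hpos : 0 < ‖toPlane v₁‖⁻¹ * |D| :=
    mul_pos (inv_pos.2 (norm_pos_iff.2 (toPlane_ne_zero hv₁))) (abs_pos.2 hD)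
  have hlim := (tendsto_abs_component hk hh hv₁ hkv hm₁).mul_const |D|
  have hrem : Tendsto (fun j => |h j * Q + h j * m₂ j * F - h j * m₁ j * E|) atTop (𝓝 0) := by
    have := (((hh0.mul_const Q).add (hm₂.mul_const F)).sub (hm₁.mul_const E)).abs
    simpa using this
  filter_upwards [hrem.eventually_lt hlim hpos] with j hj hjq
  have h1 : toPlane (k j) = toPlane (l j) + toPlane q := by
    rw [← hjq]; ext i; simp [toPlane]
  have h2 := congrArg (inner ℝ (toPlane (rot v₂))) h1
  rw [inner_add_right, inner_toPlane_of_eq (hkv j), inner_toPlane_of_eq (hlv j), h0] at h2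
  rw [← abs_mul] at hj
  refine hj.ne ?_
  congr 1
  linear_combination -(h j) * h2

end Sequences

/-! ### Rational directions -/

lemma smul_mem_rationalDirections {v : IntLattice} (hv : IsCoprime (v 0) (v 1)) :
    ‖toPlane v‖⁻¹ • toPlane v ∈ rationalDirections := by
  have hv0 : v ≠ 0 := by
    rintro rfl
    exact not_isCoprime_zero_zero hv
  refine ⟨AddSubgroup.zmultiples v, v, ⟨?_, fun k hk => ?_⟩, rfl, rfl⟩
  · rw [span_toPlane_zmultiples, finrank_span_singleton (toPlane_ne_zero hv0)]
  · rw [span_toPlane_zmultiples, mem_span_toPlane_singleton hv0] at hk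
    obtain ⟨a, b, hab⟩ := hv
    refine AddSubgroup.mem_zmultiples_iff.2 ⟨a * k 0 + b * k 1, ?_⟩
    ext i
    fin_cases i
    · simp
      linear_combination k 0 * hab - b * hk
    · simp
      linear_combination k 1 * hab + a * hk

/-- An irrational unit vector is orthogonal to no nonzero lattice vector. -/
lemma inner_ne_zero_of_notMem_rationalDirections {w : Plane} (hw1 : ‖w‖ = 1)
    (hw : w ∉ rationalDirections) {q : IntLattice} (hq : q ≠ 0) :
    inner ℝ (toPlane q) w ≠ (0 : ℝ) := by
  intro h0
  have hg : 0 < Int.gcd (q 0) (q 1) := by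
    refine Nat.pos_of_ne_zero fun h => hq ?_
    rw [Int.gcd_eq_zero_iff] at h
    ext i
    fin_cases i <;> simp [h.1, h.2]
  obtain ⟨g, a, b, hg0, hab, hqa, hqb⟩ := Int.exists_gcd_one' hg
  rw [← Int.isCoprime_iff_gcd_eq_one] at hab
  set v : IntLattice := ![-b, a] with hv
  have hvc : IsCoprime (v 0) (v 1) := by
    simpa [hv] using hab.symm.neg_left
  have hvc' : IsCoprime ((-v) 0) ((-v) 1) := by
    simpa using hvc.neg_neg
  have hn2 : ‖toPlane v‖ ^ 2 = (a : ℝ) ^ 2 + (b : ℝ) ^ 2 := by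
    rw [norm_toPlane_sq]; simp [hv]; ring
  have hvn : 0 < ‖toPlane v‖ := by
    refine norm_pos_iff.2 (toPlane_ne_zero ?_)
    intro h
    rw [h] at hvc
    exact not_isCoprime_zero_zero hvc
  have hg' : (g : ℝ) ≠ 0 := by exact_mod_cast hg0.ne'
  have horth : a * w 0 + b * w 1 = 0 := by
    rw [inner_toPlane, hqa, hqb] at h0
    push_cast at h0
    have : (g : ℝ) * (a * w 0 + b * w 1) = 0 := by linear_combination h0
    simpa [hg'] using this
  have hw2 : w 0 ^ 2 + w 1 ^ 2 = 1 := by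
    have := EuclideanSpace.norm_sq_eq w
    rw [hw1] at this
    simpa [Fin.sum_univ_two] using this.symm
  set c : ℝ := -b * w 0 + a * w 1 with hc
  have hc2 : c ^ 2 = ‖toPlane v‖ ^ 2 := by
    rw [hn2, hc]
    linear_combination ((a : ℝ) ^ 2 + (b : ℝ) ^ 2) * hw2 - (a * w 0 + b * w 1) * horth
  have hwc : (‖toPlane v‖ ^ 2) • w = c • toPlane v := by
    rw [hn2]
    ext i
    fin_cases i
    · simp [hc, hv, toPlane]
      linear_combination (a : ℝ) * horth
    · simp [hc, hv, toPlane]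
      linear_combination (b : ℝ) * horth
  have hw3 : w = ((‖toPlane v‖ ^ 2)⁻¹ * c) • toPlane v := by
    rw [mul_smul, ← hwc, smul_smul, inv_mul_cancel₀ (by positivity), one_smul]
  rcases sq_eq_sq_iff_eq_or_eq_neg.1 hc2 with h | h
  · refine hw ?_
    rw [hw3, h]
    convert! smul_mem_rationalDirections hvc using 2
    field_simp
  · refine hw ?_
    rw [hw3, h]
    convert! smul_mem_rationalDirections hvc' using 1
    rw [toPlane_neg, norm_neg, smul_neg, ← neg_smul]
    congr 1
    field_simp

lemma IsPrimitiveRankOne.cross_ne_zero {Λ₁ Λ₂ : AddSubgroup IntLattice} {v₁ v₂ : IntLattice}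
    (h₁ : IsPrimitiveRankOne Λ₁) (hv₁ : IsGenerator v₁ Λ₁) (h₂ : IsPrimitiveRankOne Λ₂)
    (hv₂ : IsGenerator v₂ Λ₂) (hne : Λ₁ ≠ Λ₂) : v₁ 0 * v₂ 1 - v₁ 1 * v₂ 0 ≠ 0 := by
  intro h0
  obtain ⟨a, ha⟩ := h₁.mem_of_cross_eq hv₁ (k := v₂) (by linarith)
  obtain ⟨b, hb⟩ := h₂.mem_of_cross_eq hv₂ (k := v₁) (by linarith)
  refine hne (le_antisymm ?_ ?_)
  · rw [← show AddSubgroup.zmultiples v₁ = Λ₁ from hv₁,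
      ← show AddSubgroup.zmultiples v₂ = Λ₂ from hv₂, AddSubgroup.zmultiples_le]
    exact AddSubgroup.mem_zmultiples_iff.2 ⟨b, hb⟩
  · rw [← show AddSubgroup.zmultiples v₁ = Λ₁ from hv₁,
      ← show AddSubgroup.zmultiples v₂ = Λ₂ from hv₂, AddSubgroup.zmultiples_le]
    exact AddSubgroup.mem_zmultiples_iff.2 ⟨a, ha⟩

lemma IsSmooth.continuous {F : Type*} [NormedAddCommGroup F] [NormedSpace ℝ F] {f : Torus → F}
    (hf : IsSmooth f) : Continuous f :=
  isOpenQuotientMap_proj.isQuotientMap.continuous_iff.2 (ContDiff.continuous hf)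

end LoschmidtEcho

end

theorem mainTheorem3
    -- the smooth real potential
    (V : Torus → ℝ) (hV : IsSmooth V)
    -- the semiclassical parameter and the size of the perturbation, `h² ≪ ε ≪ h`
    (h ε : ℕ → ℝ) (hh : ∀ j, 0 < h j) (hε : ∀ j, 0 < ε j)
    (hh0 : Tendsto h atTop (𝓝 0))
    (hsmall : Tendsto (fun j => h j ^ 2 / ε j) atTop (𝓝 0))
    (hlarge : Tendsto (fun j => ε j / h j) atTop (𝓝 0))
    -- the initial data and the unperturbed and perturbed evolutions
    (ψ : ℕ → L2Torus) (u uε : ℕ → ℝ → L2Torus)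
    (hu : ∀ j, IsSchrodingerSolution (h j) (fun _ => 0) (ψ j) (u j))
    (huε : ∀ j, IsSchrodingerSolution (h j) (fun x => ε j * V x) (ψ j) (uε j))
    (t : ℝ) :
    -- (1), irrational limit direction
    (∀ (k : ℕ → IntLattice) (w : Plane),
      (∀ j, h j = ‖toPlane (k j)‖⁻¹) →
      (∀ j, ψ j = planeWave (k j)) →
      Tendsto (fun j => ‖toPlane (k j)‖⁻¹ • toPlane (k j))
        atTop (𝓝 w) →
      w ∉ rationalDirections →
      Tendsto (fun j => echo (uε j) (u j) (t * (h j / ε j))) atTop (𝓝 1)) ∧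
    -- (1), rational limit direction approached slowly
    (∀ (k : ℕ → IntLattice) (Λ₀ : AddSubgroup IntLattice)
        (v₀ : IntLattice) (n m : ℕ → ℝ),
      (∀ j, h j = ‖toPlane (k j)‖⁻¹) →
      (∀ j, ψ j = planeWave (k j)) →
      IsPrimitiveRankOne Λ₀ → IsGenerator v₀ Λ₀ →
      (∀ j, toPlane (k j) =
        n j • toPlane v₀ + m j • toPlane (rot v₀)) →
      Tendsto (fun j => |m j| * h j) atTop (𝓝 0) →
      Tendsto (fun j => 2 * Real.pi * |m j| * h j ^ 2 / ε j) atTop atTop →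
      Tendsto (fun j => echo (uε j) (u j) (t * (h j / ε j))) atTop (𝓝 1)) ∧
    -- (2), rational limit direction approached at the critical rate
    (∀ (k : ℕ → IntLattice) (Λ₀ : AddSubgroup IntLattice)
        (v₀ : IntLattice) (n m : ℕ → ℝ) (ω : ℝ),
      (∀ j, h j = ‖toPlane (k j)‖⁻¹) →
      (∀ j, ψ j = planeWave (k j)) →
      IsPrimitiveRankOne Λ₀ → IsGenerator v₀ Λ₀ →
      (∀ j, toPlane (k j) =
        n j • toPlane v₀ + m j • toPlane (rot v₀)) →
      Tendsto (fun j => |m j| * h j) atTop (𝓝 0) →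
      Tendsto (fun j => 2 * Real.pi * m j * h j ^ 2 / ε j) atTop (𝓝 ω) →
      Tendsto (fun j => echo (uε j) (u j) (t * (h j / ε j))) atTop
        (𝓝 (‖transportIntegral V Λ₀ v₀ ω t‖ ^ 2))) ∧
    -- (3), superposition of two plane waves
    (∀ (k l : ℕ → IntLattice) (Λ₁ Λ₂ : AddSubgroup IntLattice)
        (v₁ v₂ : IntLattice) (n₁ m₁ n₂ m₂ : ℕ → ℝ) (ω₁ ω₂ : ℝ),
      (∀ j, ‖toPlane (k j)‖ = (h j)⁻¹) →
      (∀ j, ‖toPlane (l j)‖ = (h j)⁻¹) →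
      (∀ j, ψ j = ((1 / Real.sqrt 2 : ℝ) : ℂ) •
        (planeWave (k j) + planeWave (l j))) →
      IsPrimitiveRankOne Λ₁ → IsGenerator v₁ Λ₁ →
      IsPrimitiveRankOne Λ₂ → IsGenerator v₂ Λ₂ →
      Λ₁ ≠ Λ₂ →
      (∀ j, toPlane (k j) =
        n₁ j • toPlane v₁ + m₁ j • toPlane (rot v₁)) →
      (∀ j, toPlane (l j) =
        n₂ j • toPlane v₂ + m₂ j • toPlane (rot v₂)) →
      Tendsto (fun j => 2 * Real.pi * m₁ j * h j ^ 2 / ε j) atTop (𝓝 ω₁) →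
      Tendsto (fun j => 2 * Real.pi * m₂ j * h j ^ 2 / ε j) atTop (𝓝 ω₂) →
      Tendsto (fun j => echo (uε j) (u j) (t * (h j / ε j))) atTop
        (𝓝 (‖(1 / 2 : ℂ) * (transportIntegral V Λ₁ v₁ ω₁ t +
          transportIntegral V Λ₂ v₂ ω₂ t)‖ ^ 2))) := by
  set Vc : C(Torus, ℂ) := ⟨fun x => (V x : ℂ), Complex.continuous_ofReal.comp hV.continuous⟩
    with hVc
  have hVx : ∀ x, Vc x = V x := fun _ => rfl
  have hinv : ∀ {k : ℕ → IntLattice}, (∀ j, h j = ‖toPlane (k j)‖⁻¹) →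
      ∀ j, ‖toPlane (k j)‖ = (h j)⁻¹ := fun hk j => by rw [hk, inv_inv]
  have habs : ∀ {m : ℕ → ℝ}, Tendsto (fun j => |m j| * h j) atTop (𝓝 0) →
      Tendsto (fun j => h j * m j) atTop (𝓝 0) := by
    intro m hm
    rw [tendsto_zero_iff_norm_tendsto_zero]
    refine hm.congr fun j => ?_
    rw [norm_mul, Real.norm_eq_abs, Real.norm_eq_abs, abs_of_pos (hh j), mul_comm]
  refine ⟨?_, ?_, ?_, ?_⟩
  · intro k w hk hψ hw hwr
    have hlim := tendsto_echo_planeWave hVx hh hε hsmall hu huε hψ (t := t) (G := meanPhase t Vc)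
      (tendsto_lineIntegral_meanPhase (fun q hq => ?_) Vc)
    · rwa [norm_coeff_exp_meanPhase hVx, one_pow] at hlim
    · have hw1 : ‖w‖ = 1 := by
        refine tendsto_nhds_unique hw.norm (tendsto_const_nhds.congr fun j => ?_)
        have hpos : 0 < ‖toPlane (k j)‖ := by
          have := hh j
          rw [hk] at this
          exact inv_pos.1 this
        rw [norm_smul, norm_inv, norm_norm, inv_mul_cancel₀ hpos.ne']
      refine tendsto_abs_inner_velocity hh hε hlarge
        (abs_pos.2 (inner_ne_zero_of_notMem_rationalDirections hw1 hwr hq)) ?_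
      refine ((tendsto_const_nhds.inner hw).abs).congr fun j => ?_
      rw [inner_smul_right, ← hk]
  · intro k Λ₀ v₀ n m hk hψ hΛ hv hnm hm hinf
    have hv0 := hΛ.gen_ne_zero hv
    have hlim := tendsto_echo_planeWave hVx hh hε hsmall hu huε hψ (t := t) (G := meanPhase t Vc)
      (tendsto_lineIntegral_meanPhase (fun q hq => ?_) Vc)
    · rwa [norm_coeff_exp_meanPhase hVx, one_pow] at hlim
    · by_cases h0 : inner ℝ (toPlane q) (toPlane v₀) = (0 : ℝ)
      · have h1 : inner ℝ (toPlane q) (toPlane (rot v₀)) ≠ (0 : ℝ) := fun h1 =>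
          hq (eq_zero_of_inner_eq_zero hv0 h0 h1)
        refine (hinf.atTop_mul_const (abs_pos.2 h1)).congr fun j => ?_
        rw [inner_velocity_of_inner_eq_zero (hnm j) h0]
        simp only [abs_mul, abs_div, abs_pow, abs_of_pos (hh j), abs_of_pos (hε j),
          abs_of_pos Real.pi_pos, abs_two]
      · exact tendsto_abs_inner_velocity_of_component hh hε hlarge (hinv hk) hv0 hnm (habs hm) h0
  · intro k Λ₀ v₀ n m ω hk hψ hΛ hv hnm hm hω
    have hlim := tendsto_echo_planeWave hVx hh hε hsmall hu huε hψ
      (tendsto_lineIntegral_resonantPhase hh hε hlarge (hinv hk) (hΛ.gen_ne_zero hv) hnm (habs hm)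
        hω t Vc)
    rwa [coeff_zero_exp_resonantPhase hΛ hv hVx, RCLike.norm_conj] at hlim
  · intro k l Λ₁ Λ₂ v₁ v₂ n₁ m₁ n₂ m₂ ω₁ ω₂ hk hl hψ hΛ₁ hv₁ hΛ₂ hv₂ hne hkv hlv hω₁ hω₂
    -- a bounded critical rate forces `h m = (m h² / ε) (ε / h)` to vanish in the limit
    have hm : ∀ {m : ℕ → ℝ} {ω : ℝ},
        Tendsto (fun j => 2 * Real.pi * m j * h j ^ 2 / ε j) atTop (𝓝 ω) →
        Tendsto (fun j => h j * m j) atTop (𝓝 0) := by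
      intro m ω hω
      have h1 := (hω.mul hlarge).const_mul (2 * Real.pi)⁻¹
      rw [mul_zero, mul_zero] at h1
      refine h1.congr fun j => ?_
      have := (hh j).ne'
      have := (hε j).ne'
      field_simp
    have hlim := tendsto_echo_superposition hVx hh hε hsmall hu huε hψ
      (fun j => (hk j).trans (hl j).symm)
      (tendsto_sub_cofinite hh hh0 hk (hΛ₁.gen_ne_zero hv₁)
        (hΛ₁.cross_ne_zero hv₁ hΛ₂ hv₂ hne) hkv hlv (hm hω₁) (hm hω₂))
      (tendsto_lineIntegral_resonantPhase hh hε hlarge hk (hΛ₁.gen_ne_zero hv₁) hkv (hm hω₁)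
        hω₁ t Vc)
      (tendsto_lineIntegral_resonantPhase hh hε hlarge hl (hΛ₂.gen_ne_zero hv₂) hlv (hm hω₂)
        hω₂ t Vc)
    rw [coeff_zero_exp_resonantPhase hΛ₁ hv₁ hVx, coeff_zero_exp_resonantPhase hΛ₂ hv₂ hVx,
      ← map_add, norm_mul, RCLike.norm_conj, ← norm_mul] at hlim
    exact hlim
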